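/- Graphs are finite and may have parallel edges and loops; each loop contributes $2$ to the degree of its vertex. An \emph{immersion} of a graph $H$ in a graph $G$ is a function $\theta$ on the vertices and edges of $H$ such that (1) $\theta(v)\in V(G)$ for each $v\in V(H)$, and $\theta$ is injective on $V(H)$; (2) for each $e\in E(H)$, $\theta(e)$ is a connected subgraph of $G$, and $\theta(e)$ and $\theta(f)$ are edge-disjoint for distinct $e,f\in E(H)$; (3) if $e\in E(H)$ is incident with $v\in V(H)$, then $\theta(v)$ is a vertex of $\theta(e)$, and if $e$ is a loop at $v$, then $\theta(e)$ contains a cycle passing through $\theta(v)$ (a loop is a cycle of length $1$, and two parallel edges form a cycle of length $2$). The immersion $\theta$ is \emph{strong} if, moreover, $\theta(v)\notin V(\theta(e))$ whenever $e\in E(H)$ is not incident with $v\in V(H)$; $H$ is \emph{strongly immersed} in $G$ if there is a strong immersion of $H$ in $G$. A graph is \emph{$k$-edge-connected} if it remains connected after the deletion of any fewer than $k$ edges. For a positive integer $k$ let $d(k)=(2k+1)^{8k+4}k^2(k+1)$. Let $k\ge 3$ be an integer, let $F$ be a graph of maximum degree at most $k$, and let $G$ be a $k$-edge-connected graph. If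 $G$ has a vertex $c$ with at least $d(k)\,|V(F)|$ distinct neighbours (vertices other than $c$ joined to $c$ by an edge), then $F$ is strongly immersed in $G$. -/

import Mathlib

namespace Graph

/-- A multigraph (parallel edges and loops allowed) is finite if it has finitely many vertices and
finitely many edges. -/
def IsFinite {α β : Type*} (G : Graph α β) : Prop :=
  G.vertexSet.Finite ∧ G.edgeSet.Finite

/-- The degree of a vertex: the number of incident edges, each loop counted twice. -/
noncomputable def vertexDegree {α β : Type*} (G : Graph α β) (v : α) : ℕ∞ :=
  (G.incidenceSet v).encard + (G.loopSet v).encard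

/-- Every vertex has degree at most `k`. -/
def MaxDegreeLE {α β : Type*} (G : Graph α β) (k : ℕ) : Prop :=
  ∀ v ∈ G.vertexSet, G.vertexDegree v ≤ k

/-- The set of neighbours of `v`: the vertices other than `v` that are adjacent to `v`. -/
def neighbours {α β : Type*} (G : Graph α β) (v : α) : Set α :=
  {w | w ≠ v ∧ G.Adj v w}

/-- A multigraph is connected if it has a vertex and any two of its vertices are joined by
a walk. -/
def IsConnected {α β : Type*} (G : Graph α β) : Prop :=
  G.vertexSet.Nonempty ∧
    ∀ x ∈ G.vertexSet, ∀ y ∈ G.vertexSet, Relation.ReflTransGen G.Adj x y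

/-- A multigraph is `k`-edge-connected if deleting fewer than `k` edges never disconnects it. -/
def IsEdgeConnected {α β : Type*} (G : Graph α β) (k : ℕ) : Prop :=
  ∀ X : Set β, X ⊆ G.edgeSet → X.encard < k → (G.deleteEdges X).IsConnected

/-- `G` contains a cycle through `v`: there are `n ≥ 1` distinct vertices `x 0 = v, …, x (n - 1)`
and `n` distinct edges `e 0, …, e (n - 1)` such that `e i` joins `x i` and `x (i + 1)`, with
indices modulo `n`. A loop is a cycle of length one and two parallel edges form a cycle of
length two. -/
def HasCycleThrough {α β : Type*} (G : Graph α β) (v : α) : Prop :=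
  ∃ (n : ℕ) (_ : NeZero n) (x : Fin n → α) (e : Fin n → β),
    Function.Injective x ∧ Function.Injective e ∧
      (∀ i, G.IsLink (e i) (x i) (x (i + 1))) ∧ x 0 = v

/-- An immersion of `H` in `G`: an injection of the vertices of `H` into the vertices of `G`,
together with pairwise edge-disjoint connected subgraphs of `G`, one for each edge of `H`, such
that the subgraph of an edge contains the images of the ends of the edge, and the subgraph of
a loop contains a cycle through the image of its end. -/
structure Immersion {α β γ δ : Type*} (H : Graph α β) (G : Graph γ δ) where
  /-- the image of a vertex -/
  vert : H.vertexSet → G.vertexSet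
  /-- the image of an edge -/
  edge : H.edgeSet → Graph γ δ
  vert_injective : Function.Injective vert
  edge_le : ∀ e, edge e ≤ G
  edge_connected : ∀ e, (edge e).IsConnected
  edge_disjoint : ∀ e f, e ≠ f → Disjoint (edge e).edgeSet (edge f).edgeSet
  mem_of_inc : ∀ (e : H.edgeSet) (v : H.vertexSet),
    H.Inc e v → (vert v : γ) ∈ (edge e).vertexSet
  cycle_of_loop : ∀ (e : H.edgeSet) (v : H.vertexSet),
    H.IsLoopAt e v → (edge e).HasCycleThrough (vert v)

/-- An immersion is strong if the subgraph of an edge avoids the images of all vertices that are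
not incident with the edge. -/
def Immersion.IsStrong {α β γ δ : Type*} {H : Graph α β} {G : Graph γ δ}
    (θ : Immersion H G) : Prop :=
  ∀ (e : H.edgeSet) (v : H.vertexSet), ¬ H.Inc e v → (θ.vert v : γ) ∉ (θ.edge e).vertexSet

/-- `H` is strongly immersed in `G`. -/
def StronglyImmersed {α β γ δ : Type*} (H : Graph α β) (G : Graph γ δ) : Prop :=
  ∃ θ : Immersion H G, θ.IsStrong

/-- The function `d(k) = (2k + 1)^(8k + 4) k^2 (k + 1)`. -/
def immersionBound (k : ℕ) : ℕ :=
  (2 * k + 1) ^ (8 * k + 4) * k ^ 2 * (k + 1)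

end Graph

/-!
The vertex `c` serves as a hub. It suffices to find a set `T` of `|V(F)|` neighbours of `c`, the
terminals, from each of which `k` trails lead to `c`, all trails being edge-disjoint and none
passing through a further terminal. Placing the vertices of `F` at the terminals, each half-edge of
`F` gets a trail of its own, and an edge of `F` is mapped to the union of the trails of its two
half-edges. For a loop these are two edge-disjoint trails from a terminal to `c`, and their union
contains a cycle through the terminal.

By a directed version of Menger's theorem (`CutCondition.exists_trails`) such trails exist as soon
as every vertex set `A` avoiding `c` sends at least `k * |A ∩ T|` edges to vertices outside `A ∪ T`.
Trails are directed and could use an edge in both directions; starting from an arc-minimal digraph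
excludes this (`not_opposite_of_minimal`). It remains to choose `T`, and this only concerns cuts.

Double all edges, so that the graph becomes Eulerian. Then every vertex outside `N ∪ {c}`, where `N`
is the set of neighbours of `c`, can be split off completely without losing `2k`-edge-connectivity
(Lovász; `exists_split_all`), and the cuts in question do not grow. Next lower the weights
inside `N` as long as all cuts around subsets of `N` are at least `2k`. In the end adjacent vertices
are separated by a cut of weight exactly `2k`, hence each `X ⊆ N` spans weight at most
`2k (|X| - 1)`, and the graph on `N` has an orientation with out-degrees at most `4k`
(`exists_orientation`). At least half of the vertices have in-degree below `8k`; call these low and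
the others high. At each high vertex `v` the in-neighbours are partitioned into groups of between
`2k` and `4k` vertices, and every other neighbour of `v` is assigned to one of the groups.

The zone of a low vertex `t` consists of the vertices reached by at most `k` steps through low
vertices, together with the group at a high vertex `v` of each vertex so reached that is adjacent to
`v`. A zone meets boundedly many others, so a greedy choice produces enough low vertices with
pairwise disjoint zones; these form `T`. To verify the cut condition for `A`, walk from `t ∈ A ∩ T`
through low vertices of `A`. Either `k` vertices are met, and each of them is joined to `c` by two
edges of the doubled graph; or the walk meets a high vertex `v ∈ A`, and each of the at least `2k`
vertices of the group contributes its edge to `c` or its edge to `v`; or the vertices met form a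
component of `A`, from which at least `2k` edges leave. In each case `2k` edges leaving `A`
are found that belong to the zone of `t` (`Grouping.le_sum_credit`), and zones are disjoint.
-/

/-! ### Arc-disjoint trails to a sink -/

section Trails

open Classical in
/-- The arcs of `D` that leave the vertex set `A`, where `s` and `t` give the tail and the head of an
arc. -/
noncomputable def outArcs {ι V : Type*} (s t : ι → V) (D : Finset ι) (A : Finset V) : Finset ι :=
  D.filter fun e => s e ∈ A ∧ t e ∉ A

open Classical in
/-- The tokens of `S` whose position `p` lies in `A`. -/
noncomputable def tokensIn {V τ : Type*} (p : τ → V) (S : Finset τ) (A : Finset V) : Finset τ :=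
  S.filter fun x => p x ∈ A

/-- The cut condition for sending all tokens of `S` to the sink `c` along pairwise different arcs
of `D`: a set that avoids `c` has at least as many outgoing arcs as tokens. -/
def CutCondition {ι V τ : Type*} (s t : ι → V) (c : V) (S : Finset τ) (p : τ → V)
    (D : Finset ι) : Prop :=
  ∀ A : Finset V, c ∉ A → (tokensIn p S A).card ≤ (outArcs s t D A).card

variable {ι V τ : Type*} (s t : ι → V)

open Classical in
lemma card_outArcs_inter_add_union_le (D : Finset ι) (A B : Finset V) :
    (outArcs s t D (A ∩ B)).card + (outArcs s t D (A ∪ B)).card ≤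
      (outArcs s t D A).card + (outArcs s t D B).card := by
  simp only [outArcs, Finset.card_filter, ← Finset.sum_add_distrib]
  refine Finset.sum_le_sum fun e _ => ?_
  by_cases h1 : s e ∈ A <;> by_cases h2 : s e ∈ B <;> by_cases h3 : t e ∈ A <;>
    by_cases h4 : t e ∈ B <;> simp [h1, h2, h3, h4]

open Classical in
lemma card_outArcs_inter_add_union_lt (D : Finset ι) (A B : Finset V) {e : ι} (he : e ∈ D)
    (h1 : s e ∈ A) (h2 : s e ∉ B) (h3 : t e ∉ A) (h4 : t e ∈ B) :
    (outArcs s t D (A ∩ B)).card + (outArcs s t D (A ∪ B)).card <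
      (outArcs s t D A).card + (outArcs s t D B).card := by
  simp only [outArcs, Finset.card_filter, ← Finset.sum_add_distrib]
  refine Finset.sum_lt_sum (fun e _ => ?_) ⟨e, he, by simp [h1, h2, h3, h4]⟩
  by_cases h1 : s e ∈ A <;> by_cases h2 : s e ∈ B <;> by_cases h3 : t e ∈ A <;>
    by_cases h4 : t e ∈ B <;> simp [h1, h2, h3, h4]

open Classical in
lemma card_tokensIn_inter_add_union (S : Finset τ) (p : τ → V) (A B : Finset V) :
    (tokensIn p S (A ∩ B)).card + (tokensIn p S (A ∪ B)).card =
      (tokensIn p S A).card + (tokensIn p S B).card := by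
  simp only [tokensIn, Finset.card_filter, ← Finset.sum_add_distrib]
  refine Finset.sum_congr rfl fun e _ => ?_
  by_cases h1 : p e ∈ A <;> by_cases h2 : p e ∈ B <;> simp [h1, h2]

open Classical in
/-- The union of tight sets is tight. -/
lemma CutCondition.card_union_eq {s t : ι → V} {c : V} {S : Finset τ} {p : τ → V} {D : Finset ι}
    (h : CutCondition s t c S p D) {A B : Finset V} (hA : c ∉ A) (hB : c ∉ B)
    (hA' : (outArcs s t D A).card = (tokensIn p S A).card)
    (hB' : (outArcs s t D B).card = (tokensIn p S B).card) :
    (outArcs s t D (A ∪ B)).card = (tokensIn p S (A ∪ B)).card := by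
  have h1 := h (A ∩ B) (by simp [hA])
  have h2 := h (A ∪ B) (by simp [hA, hB])
  have h3 := card_outArcs_inter_add_union_le s t D A B
  have h4 := card_tokensIn_inter_add_union S p A B
  omega

open Classical in
/-- In an arc-minimal set satisfying the cut condition, no two arcs are opposite: each would leave
a tight set that the other enters, against submodularity. -/
lemma not_opposite_of_minimal {c : V} {S : Finset τ} {p : τ → V} {D : Finset ι}
    (hD : Minimal (CutCondition s t c S p) D) {e f : ι} (he : e ∈ D) (hf : f ∈ D)
    (h1 : s e = t f) (h2 : t e = s f) : False := by
  have key : ∀ g ∈ D, ∃ A : Finset V, c ∉ A ∧ s g ∈ A ∧ t g ∉ A ∧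
      (outArcs s t D A).card = (tokensIn p S A).card := by
    intro g hg
    have hn : ¬ CutCondition s t c S p (D.erase g) := by
      intro hP
      have := hD.le_of_le hP (Finset.erase_subset g D)
      exact Finset.notMem_erase g D (this hg)
    simp only [CutCondition, not_forall] at hn
    obtain ⟨A, hA, hlt⟩ := hn
    have hle := hD.prop A hA
    have hE : outArcs s t (D.erase g) A = (outArcs s t D A).erase g := by
      simp [outArcs, Finset.filter_erase]
    rw [hE] at hlt
    by_cases hgA : g ∈ outArcs s t D A
    · rw [Finset.card_erase_of_mem hgA] at hlt
      have hgA' := hgA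
      simp only [outArcs, Finset.mem_filter] at hgA'
      have := Finset.card_pos.2 ⟨g, hgA⟩
      exact ⟨A, hA, hgA'.2.1, hgA'.2.2, by omega⟩
    · rw [Finset.erase_eq_of_notMem hgA] at hlt
      exact absurd hle hlt
  obtain ⟨A, hcA, a1, a2, a3⟩ := key e he
  obtain ⟨B, hcB, b1, b2, b3⟩ := key f hf
  have h3 := card_outArcs_inter_add_union_lt s t D A B he a1 (h1 ▸ b2) a2 (h2 ▸ b1)
  have h4 := card_tokensIn_inter_add_union S p A B
  have h5 := hD.prop (A ∩ B) (by simp [hcA])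
  have h6 := hD.prop (A ∪ B) (by simp [hcA, hcB])
  omega

/-- `v` can be reached from `u` along arcs of `P`. -/
def ArcReach {ι V : Type*} (s t : ι → V) (P : Finset ι) : V → V → Prop :=
  Relation.ReflTransGen fun a b => ∃ e ∈ P, s e = a ∧ t e = b

lemma ArcReach.mono {s t : ι → V} {P Q : Finset ι} (h : P ⊆ Q) {u v : V}
    (hP : ArcReach s t P u v) : ArcReach s t Q u v :=
  Relation.ReflTransGen.mono (fun _ _ ⟨e, he, h'⟩ => ⟨e, h he, h'⟩) _ _ hP

open Classical in
/-- If some token has not reached the sink yet, then one arc can be used to move it such that the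
cut condition survives. -/
lemma CutCondition.exists_move {s t : ι → V} {c : V} {S : Finset τ} {p : τ → V} {D : Finset ι}
    (h : CutCondition s t c S p D) {x : τ} (hx : x ∈ S) (hxc : p x ≠ c) :
    ∃ e ∈ D, s e = p x ∧
      CutCondition s t c S (Function.update p x (t e)) (D.erase e) := by
  by_contra! hcon
  have key : ∀ e ∈ D, s e = p x → ∃ A : Finset V, c ∉ A ∧ t e ∈ A ∧ p x ∉ A ∧
      (outArcs s t D A).card = (tokensIn p S A).card := by
    intro e he hs
    have hn := hcon e he hs
    simp only [CutCondition, not_forall] at hn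
    obtain ⟨A, hA, hlt⟩ := hn
    have hle := h A hA
    have hE : outArcs s t (D.erase e) A = (outArcs s t D A).erase e := by
      simp [outArcs, Finset.filter_erase]
    have hT : (tokensIn (Function.update p x (t e)) S A).card + (if p x ∈ A then 1 else 0) =
        (tokensIn p S A).card + (if t e ∈ A then 1 else 0) := by
      simp only [tokensIn, Finset.card_filter]
      rw [← Finset.add_sum_erase S _ hx,
        ← Finset.add_sum_erase S (fun y => if p y ∈ A then 1 else 0) hx]
      have : ∑ y ∈ S.erase x, (if Function.update p x (t e) y ∈ A then 1 else 0) =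
          ∑ y ∈ S.erase x, (if p y ∈ A then 1 else 0) := by
        refine Finset.sum_congr rfl fun y hy => ?_
        rw [Function.update_of_ne (Finset.ne_of_mem_erase hy)]
      rw [this, Function.update_self]
      ring
    have hO : (outArcs s t (D.erase e) A).card + (if s e ∈ A ∧ t e ∉ A then 1 else 0) =
        (outArcs s t D A).card := by
      rw [hE]
      split_ifs with h1
      · have : e ∈ outArcs s t D A := by simp [outArcs, he, h1]
        rw [Finset.card_erase_of_mem this]
        have := Finset.card_pos.2 ⟨e, this⟩
        omega
      · rw [Finset.erase_eq_of_notMem (by simp [outArcs, he]; tauto)]; rfl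
    rw [hs] at hO
    refine ⟨A, hA, ?_⟩
    by_cases h1 : p x ∈ A <;> by_cases h2 : t e ∈ A <;> simp [h1, h2] at hT hO ⊢ <;> omega
  choose! A hA using key
  -- `B` is tight and contains the heads of all arcs leaving `p x`, so adding `p x` to `B` adds a token
  -- but no outgoing arc
  set B : Finset V := (D.filter fun e => s e = p x).biUnion A with hB
  have hBt : c ∉ B ∧ (outArcs s t D B).card = (tokensIn p S B).card := by
    have : ∀ D' ⊆ D.filter fun e => s e = p x, c ∉ D'.biUnion A ∧
        (outArcs s t D (D'.biUnion A)).card = (tokensIn p S (D'.biUnion A)).card := by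
      intro D'
      induction D' using Finset.induction_on with
      | empty => intro _; simp [outArcs, tokensIn]
      | insert e D' _ ih =>
        intro hsub
        obtain ⟨i1, i2⟩ := ih fun y hy => hsub (Finset.mem_insert_of_mem hy)
        have he := hsub (Finset.mem_insert_self e D')
        rw [Finset.mem_filter] at he
        obtain ⟨a1, a2, a3, a4⟩ := hA e he.1 he.2
        rw [Finset.biUnion_insert]
        exact ⟨by simp only [Finset.mem_union]; tauto, h.card_union_eq a1 i1 a4 i2⟩
    exact this _ subset_rfl
  have hxB : p x ∉ B := by
    simp only [hB, Finset.mem_biUnion, Finset.mem_filter, not_exists, not_and]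
    intro e he
    exact (hA e he.1 he.2).2.2.1
  have h1 := h (insert (p x) B) (by simp [hBt.1, Ne.symm hxc])
  have h2 : outArcs s t D (insert (p x) B) ⊆ outArcs s t D B := by
    intro e he
    simp only [outArcs, Finset.mem_filter, Finset.mem_insert, not_or] at he ⊢
    refine ⟨he.1, ?_, he.2.2.2⟩
    rcases he.2.1 with h3 | h3
    · exact absurd (Finset.mem_biUnion.2 ⟨e, by simp [he.1, h3], (hA e he.1 h3).2.1⟩) he.2.2.2
    · exact h3
  have h3 : tokensIn p S B ⊂ tokensIn p S (insert (p x) B) := by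
    refine Finset.ssubset_iff_of_subset (fun y => ?_) |>.2 ⟨x, ?_, ?_⟩
    · simp only [tokensIn, Finset.mem_filter, Finset.mem_insert]; tauto
    · simp [tokensIn, hx]
    · simp [tokensIn, hxB]
  have := Finset.card_lt_card h3
  have := Finset.card_le_card h2
  omega

open Classical in
/-- The directed edge version of Menger's theorem for several sources and one sink: under the cut
condition the tokens have pairwise arc-disjoint trails to the sink. -/
theorem CutCondition.exists_trails {s t : ι → V} {c : V} {S : Finset τ} {p : τ → V} {D : Finset ι}
    (h : CutCondition s t c S p D) :
    ∃ P : τ → Finset ι, (∀ x ∈ S, P x ⊆ D) ∧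
      (∀ x ∈ S, ∀ y ∈ S, x ≠ y → Disjoint (P x) (P y)) ∧
      (∀ x ∈ S, ArcReach s t (P x) (p x) c) ∧
      (∀ x ∈ S, ∀ e ∈ P x, ArcReach s t (P x) (p x) (s e)) := by
  induction hn : D.card generalizing D p with
  | zero =>
    refine ⟨fun _ => ∅, by simp, by simp, fun x hx => ?_, by simp⟩
    by_cases hxc : p x = c
    · rw [hxc]; exact Relation.ReflTransGen.refl
    · obtain ⟨e, he, -⟩ := h.exists_move hx hxc
      simp [Finset.card_eq_zero.1 hn] at he
  | succ n ih =>
    by_cases hall : ∀ x ∈ S, p x = c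
    · refine ⟨fun _ => ∅, by simp, by simp, fun x hx => ?_, by simp⟩
      rw [hall x hx]; exact Relation.ReflTransGen.refl
    push Not at hall
    obtain ⟨x, hx, hxc⟩ := hall
    obtain ⟨e, he, hs, hcut⟩ := h.exists_move hx hxc
    obtain ⟨P, h1, h2, h3, h4⟩ := ih hcut (by rw [Finset.card_erase_of_mem he, hn]; rfl)
    have heP : ∀ y ∈ S, e ∉ P y := fun y hy hey => Finset.notMem_erase e D (h1 y hy hey)
    have hstep : ∀ v, ArcReach s t (P x) (t e) v → ArcReach s t (insert e (P x)) (p x) v := by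
      intro v hv
      refine Relation.ReflTransGen.head ⟨e, by simp, hs, rfl⟩ ?_
      exact ArcReach.mono (Finset.subset_insert _ _) hv
    refine ⟨Function.update P x (insert e (P x)), ?_, ?_, ?_, ?_⟩
    · intro y hy
      by_cases hyx : y = x
      · subst hyx
        rw [Function.update_self]
        exact Finset.insert_subset he ((h1 y hy).trans (Finset.erase_subset _ _))
      · rw [Function.update_of_ne hyx]
        exact (h1 y hy).trans (Finset.erase_subset _ _)
    · intro y hy z hz hyz
      by_cases hyx : y = x
      · subst hyx
        rw [Function.update_self, Function.update_of_ne hyz.symm, Finset.disjoint_insert_left]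
        exact ⟨heP z hz, h2 y hy z hz hyz⟩
      · rw [Function.update_of_ne hyx]
        by_cases hzx : z = x
        · subst hzx
          rw [Function.update_self, Finset.disjoint_insert_right]
          exact ⟨heP y hy, h2 y hy z hz hyz⟩
        · rw [Function.update_of_ne hzx]
          exact h2 y hy z hz hyz
    · intro y hy
      have := h3 y hy
      by_cases hyx : y = x
      · subst hyx
        rw [Function.update_self] at this ⊢
        exact hstep _ this
      · rwa [Function.update_of_ne hyx] at this ⊢
    · intro y hy f hf
      by_cases hyx : y = x
      · subst hyx
        rw [Function.update_self] at hf ⊢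
        rcases Finset.mem_insert.1 hf with rfl | hf
        · rw [hs]; exact Relation.ReflTransGen.refl
        · have := h4 y hy f hf
          rw [Function.update_self] at this
          exact hstep _ this
      · rw [Function.update_of_ne hyx] at hf ⊢
        have := h4 y hy f hf
        rwa [Function.update_of_ne hyx] at this

end Trails

/-! ### Cuts of weighted graphs and complete splitting -/

section Splitting

/-- The total weight between the vertex sets `A` and `B`. -/
def cutWeight {V : Type*} (w : V → V → ℕ) (A B : Finset V) : ℕ :=
  ∑ a ∈ A, ∑ b ∈ B, w a b

open Classical in
/-- The weight function of a single edge joining `a` and `b`; it is zero if `a = b`. -/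
noncomputable def edgeWeight {V : Type*} (a b : V) (x y : V) : ℕ :=
  if x ≠ y ∧ ((x = a ∧ y = b) ∨ (x = b ∧ y = a)) then 1 else 0

variable {V : Type*}

lemma cutWeight_mono (w : V → V → ℕ) {A A' B B' : Finset V} (hA : A ⊆ A') (hB : B ⊆ B') :
    cutWeight w A B ≤ cutWeight w A' B' :=
  (Finset.sum_le_sum fun _ _ => Finset.sum_le_sum_of_subset hB).trans
    (Finset.sum_le_sum_of_subset hA)

lemma cutWeight_mono_weight {w w' : V → V → ℕ} {A B : Finset V}
    (h : ∀ a ∈ A, ∀ b ∈ B, w a b ≤ w' a b) : cutWeight w A B ≤ cutWeight w' A B :=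
  Finset.sum_le_sum fun a ha => Finset.sum_le_sum fun b hb => h a ha b hb

lemma cutWeight_comm {w : V → V → ℕ} (hw : ∀ a b, w a b = w b a) (A B : Finset V) :
    cutWeight w A B = cutWeight w B A := by
  unfold cutWeight
  rw [Finset.sum_comm]
  simp_rw [fun a b => hw a b]

lemma cutWeight_add (w w' : V → V → ℕ) (A B : Finset V) :
    cutWeight (fun x y => w x y + w' x y) A B = cutWeight w A B + cutWeight w' A B := by
  simp [cutWeight, Finset.sum_add_distrib]

open Classical in
lemma cutWeight_union_left (w : V → V → ℕ) {A B : Finset V} (h : Disjoint A B) (C : Finset V) :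
    cutWeight w (A ∪ B) C = cutWeight w A C + cutWeight w B C :=
  Finset.sum_union h

open Classical in
lemma cutWeight_union_right (w : V → V → ℕ) {A B : Finset V} (h : Disjoint A B) (C : Finset V) :
    cutWeight w C (A ∪ B) = cutWeight w C A + cutWeight w C B := by
  simp only [cutWeight, Finset.sum_union h, Finset.sum_add_distrib]

lemma le_cutWeight (w : V → V → ℕ) {A B : Finset V} {a b : V} (ha : a ∈ A) (hb : b ∈ B) :
    w a b ≤ cutWeight w A B :=
  (Finset.single_le_sum (f := fun b => w a b) (fun _ _ => Nat.zero_le _) hb).trans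
    (Finset.single_le_sum (f := fun a => ∑ b ∈ B, w a b) (fun _ _ => Nat.zero_le _) ha)

open Classical in
lemma cutWeight_edgeWeight (a b : V) {A B : Finset V} (h : Disjoint A B) :
    cutWeight (edgeWeight a b) A B =
      (if a ∈ A ∧ b ∈ B then 1 else 0) + (if b ∈ A ∧ a ∈ B then 1 else 0) := by
  have hne : ∀ x ∈ A, ∀ y ∈ B, x ≠ y := fun x hx y hy => by
    rintro rfl; exact Finset.disjoint_left.1 h hx hy
  have h1 : cutWeight (edgeWeight a b) A B =
      cutWeight (fun x y => (if x = a ∧ y = b then 1 else 0) +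
        (if x = b ∧ y = a then 1 else 0)) A B := by
    refine Finset.sum_congr rfl fun x hx => Finset.sum_congr rfl fun y hy => ?_
    have := hne x hx y hy
    unfold edgeWeight
    by_cases h1 : x = a ∧ y = b <;> by_cases h2 : x = b ∧ y = a <;> simp [h1, h2, this] <;> grind
  have h2 : ∀ p q : V, cutWeight (fun x y => if x = p ∧ y = q then 1 else 0) A B =
      if p ∈ A ∧ q ∈ B then 1 else 0 := by
    intro p q
    simp only [cutWeight, ite_and, Finset.sum_ite_irrel, Finset.sum_const_zero,
      Finset.sum_ite_eq']
  rw [h1, cutWeight_add, h2, h2]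

open Classical in
lemma sum_edgeWeight_mod_two (p q a : V) {U : Finset V} (hp : p ∈ U) (hq : q ∈ U) :
    (∑ b ∈ U, edgeWeight p q a b) % 2 =
      ((if a = p then 1 else 0) + (if a = q then 1 else 0)) % 2 := by
  by_cases hpq : p = q
  · subst hpq
    have : ∀ b ∈ U, edgeWeight p p a b = 0 := by
      intro b _; unfold edgeWeight; rw [if_neg]; grind
    rw [Finset.sum_eq_zero this]
    split_ifs <;> rfl
  · have : ∀ b ∈ U, edgeWeight p q a b =
        (if a = p then (if b = q then 1 else 0) else 0) +
          (if a = q then (if b = p then 1 else 0) else 0) := by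
      intro b _
      unfold edgeWeight
      grind
    rw [Finset.sum_congr rfl this, Finset.sum_add_distrib]
    simp only [Finset.sum_ite_irrel, Finset.sum_ite_eq', hp, hq, if_true, Finset.sum_const_zero]

open Classical in
/-- Twice a cut, as a sum over all ordered pairs separated by it. -/
lemma two_mul_cutWeight_compl {w : V → V → ℕ} (hw : ∀ a b, w a b = w b a) {U X : Finset V}
    (hX : X ⊆ U) :
    2 * cutWeight w X (U \ X) =
      ∑ a ∈ U, ∑ b ∈ U, (if a ∈ X ↔ b ∈ X then 0 else 1) * w a b := by
  have h1 : ∑ a ∈ U, ∑ b ∈ U, (if a ∈ X ↔ b ∈ X then 0 else 1) * w a b =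
      ∑ a ∈ U, ∑ b ∈ U, ((if a ∈ X ∧ b ∉ X then w a b else 0) +
        (if a ∉ X ∧ b ∈ X then w a b else 0)) := by
    refine Finset.sum_congr rfl fun a _ => Finset.sum_congr rfl fun b _ => ?_
    by_cases ha : a ∈ X <;> by_cases hb : b ∈ X <;> simp [ha, hb]
  have h2 : ∀ (p q : V → Prop) [DecidablePred p] [DecidablePred q],
      ∑ a ∈ U, ∑ b ∈ U, (if p a ∧ q b then w a b else 0) =
      cutWeight w (U.filter p) (U.filter q) := by
    intro p q _ _
    simp only [cutWeight, Finset.sum_filter, ite_and, Finset.sum_ite_irrel, Finset.sum_const_zero]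
  have h3 : U.filter (· ∈ X) = X := by
    ext a; simp only [Finset.mem_filter]; exact ⟨fun h => h.2, fun h => ⟨hX h, h⟩⟩
  have h4 : U.filter (· ∉ X) = U \ X := by ext a; simp
  rw [h1]
  simp only [Finset.sum_add_distrib]
  rw [h2 (· ∈ X) (· ∉ X), h2 (· ∉ X) (· ∈ X), h3, h4, cutWeight_comm hw (U \ X) X, two_mul]

open Classical in
lemma cutWeight_submodular {w : V → V → ℕ} (hw : ∀ a b, w a b = w b a) {U X Y : Finset V}
    (hX : X ⊆ U) (hY : Y ⊆ U) :
    cutWeight w (X ∩ Y) (U \ (X ∩ Y)) + cutWeight w (X ∪ Y) (U \ (X ∪ Y)) ≤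
      cutWeight w X (U \ X) + cutWeight w Y (U \ Y) := by
  have h1 := two_mul_cutWeight_compl hw hX
  have h2 := two_mul_cutWeight_compl hw hY
  have h3 := two_mul_cutWeight_compl hw (Finset.inter_subset_left.trans hX : X ∩ Y ⊆ U)
  have h4 := two_mul_cutWeight_compl hw (Finset.union_subset hX hY)
  have : (∑ a ∈ U, ∑ b ∈ U, (if a ∈ X ∩ Y ↔ b ∈ X ∩ Y then 0 else 1) * w a b) +
      (∑ a ∈ U, ∑ b ∈ U, (if a ∈ X ∪ Y ↔ b ∈ X ∪ Y then 0 else 1) * w a b) ≤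
      (∑ a ∈ U, ∑ b ∈ U, (if a ∈ X ↔ b ∈ X then 0 else 1) * w a b) +
      ∑ a ∈ U, ∑ b ∈ U, (if a ∈ Y ↔ b ∈ Y then 0 else 1) * w a b := by
    simp only [← Finset.sum_add_distrib, ← add_mul]
    refine Finset.sum_le_sum fun a _ => Finset.sum_le_sum fun b _ => Nat.mul_le_mul_right _ ?_
    by_cases h1 : a ∈ X <;> by_cases h2 : a ∈ Y <;> by_cases h3 : b ∈ X <;>
      by_cases h4 : b ∈ Y <;> simp [h1, h2, h3, h4]
  omega

open Classical in
lemma cutWeight_posimodular {w : V → V → ℕ} (hw : ∀ a b, w a b = w b a) {U X Y : Finset V}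
    (hX : X ⊆ U) (hY : Y ⊆ U) :
    cutWeight w (X \ Y) (U \ (X \ Y)) + cutWeight w (Y \ X) (U \ (Y \ X)) +
      2 * cutWeight w (X ∩ Y) (U \ (X ∪ Y)) ≤
      cutWeight w X (U \ X) + cutWeight w Y (U \ Y) := by
  have h1 := two_mul_cutWeight_compl hw hX
  have h2 := two_mul_cutWeight_compl hw hY
  have h3 := two_mul_cutWeight_compl hw (Finset.sdiff_subset.trans hX : X \ Y ⊆ U)
  have h4 := two_mul_cutWeight_compl hw (Finset.sdiff_subset.trans hY : Y \ X ⊆ U)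
  have h5 : cutWeight w (X ∩ Y) (U \ (X ∪ Y)) =
      ∑ a ∈ U, ∑ b ∈ U, (if a ∈ X ∩ Y ∧ b ∉ X ∪ Y then 1 else 0) * w a b := by
    simp only [ite_mul, one_mul, zero_mul, ite_and, Finset.sum_ite_irrel, Finset.sum_const_zero]
    rw [← Finset.sum_filter]
    have e1 : U.filter (· ∈ X ∩ Y) = X ∩ Y := by
      ext a; simp only [Finset.mem_filter]
      exact ⟨fun h => h.2, fun h => ⟨hX (Finset.mem_inter.1 h).1, h⟩⟩
    have e2 : U \ (X ∪ Y) = U.filter (· ∉ X ∪ Y) := by ext a; simp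
    rw [e1, e2, cutWeight]
    simp only [Finset.sum_filter]
  have h6 : cutWeight w (X ∩ Y) (U \ (X ∪ Y)) =
      ∑ a ∈ U, ∑ b ∈ U, (if b ∈ X ∩ Y ∧ a ∉ X ∪ Y then 1 else 0) * w a b := by
    rw [h5, Finset.sum_comm]
    simp_rw [fun a b => hw a b]
  have : (∑ a ∈ U, ∑ b ∈ U, (if a ∈ X \ Y ↔ b ∈ X \ Y then 0 else 1) * w a b) +
      (∑ a ∈ U, ∑ b ∈ U, (if a ∈ Y \ X ↔ b ∈ Y \ X then 0 else 1) * w a b) +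
      2 * (∑ a ∈ U, ∑ b ∈ U, (if a ∈ X ∩ Y ∧ b ∉ X ∪ Y then 1 else 0) * w a b) +
      2 * (∑ a ∈ U, ∑ b ∈ U, (if b ∈ X ∩ Y ∧ a ∉ X ∪ Y then 1 else 0) * w a b) ≤
      (∑ a ∈ U, ∑ b ∈ U, (if a ∈ X ↔ b ∈ X then 0 else 1) * w a b) +
      ∑ a ∈ U, ∑ b ∈ U, (if a ∈ Y ↔ b ∈ Y then 0 else 1) * w a b := by
    simp only [Finset.mul_sum, ← Finset.sum_add_distrib, ← add_mul, ← mul_assoc]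
    refine Finset.sum_le_sum fun a _ => Finset.sum_le_sum fun b _ => Nat.mul_le_mul_right _ ?_
    by_cases h1 : a ∈ X <;> by_cases h2 : a ∈ Y <;> by_cases h3 : b ∈ X <;>
      by_cases h4 : b ∈ Y <;> simp [h1, h2, h3, h4]
  omega

open Classical in
lemma even_cutWeight_self {w : V → V → ℕ} (hw : ∀ a b, w a b = w b a) (h0 : ∀ a, w a a = 0)
    (X : Finset V) : Even (cutWeight w X X) := by
  induction X using Finset.induction_on with
  | empty => simp [cutWeight]
  | insert a X ha ih =>
    have hd : Disjoint {a} X := Finset.disjoint_singleton_left.2 ha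
    rw [Finset.insert_eq, cutWeight_union_left w hd, cutWeight_union_right w hd,
      cutWeight_union_right w hd, cutWeight_comm hw X {a}]
    have : cutWeight w {a} {a} = 0 := by simp [cutWeight, h0]
    rw [this, zero_add, ← add_assoc]
    exact (Even.add_self _).add ih

open Classical in
lemma even_cutWeight_compl {w : V → V → ℕ} (hw : ∀ a b, w a b = w b a) (h0 : ∀ a, w a a = 0)
    {U X : Finset V} (heven : ∀ a ∈ U, Even (∑ b ∈ U, w a b)) (hX : X ⊆ U) :
    Even (cutWeight w X (U \ X)) := by
  have h1 : Even (cutWeight w X U) := Finset.even_sum _ fun a ha => heven a (hX ha)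
  have h2 : cutWeight w X U = cutWeight w X X + cutWeight w X (U \ X) := by
    rw [← cutWeight_union_right w Finset.disjoint_sdiff, Finset.union_sdiff_of_subset hX]
  rw [h2] at h1
  exact (Nat.even_add.1 h1).1 (even_cutWeight_self hw h0 X)

/-- A loopless weighted graph on the vertex set `U` that is Eulerian. -/
structure IsEulerian (w : V → V → ℕ) (U : Finset V) : Prop where
  symm : ∀ a b, w a b = w b a
  diag : ∀ a, w a a = 0
  even : ∀ a ∈ U, Even (∑ b ∈ U, w a b)

open Classical in
/-- Every cut that separates two vertices of `U` other than `s` has weight at least `K`; edges at `s`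
count in these cuts. -/
def ConnectedOff (w : V → V → ℕ) (U : Finset V) (s : V) (K : ℕ) : Prop :=
  ∀ X ⊆ U.erase s, X.Nonempty → X ≠ U.erase s → K ≤ cutWeight w X (U \ X)

open Classical in
/-- The union of two tight sets containing a common neighbour of `s` is tight. -/
lemma ConnectedOff.union_tight {w : V → V → ℕ} {U : Finset V} {s : V} {K : ℕ}
    (hw : IsEulerian w U) (hs : s ∈ U) (h : ConnectedOff w U s K) {t : V} (ht : 0 < w s t)
    {X Y : Finset V} (hX : X ⊆ U.erase s) (hY : Y ⊆ U.erase s)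
    (hX' : X ≠ U.erase s) (hY' : Y ≠ U.erase s) (htX : t ∈ X) (htY : t ∈ Y)
    (hXK : cutWeight w X (U \ X) = K) (hYK : cutWeight w Y (U \ Y) = K) :
    X ∪ Y ≠ U.erase s ∧ cutWeight w (X ∪ Y) (U \ (X ∪ Y)) = K := by
  have hXU := hX.trans (Finset.erase_subset s U)
  have hYU := hY.trans (Finset.erase_subset s U)
  have hne : X ∪ Y ≠ U.erase s := by
    intro hU
    have hpos := cutWeight_posimodular hw.symm hXU hYU
    have h1 : K ≤ cutWeight w (X \ Y) (U \ (X \ Y)) := by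
      refine h _ (Finset.sdiff_subset.trans hX) ?_ ?_
      · rw [Finset.sdiff_nonempty]
        intro hXY
        exact hY' (by rw [← hU, Finset.union_eq_right.2 hXY])
      · intro h2
        have : t ∈ X \ Y := h2 ▸ hX htX
        simp [htY] at this
    have h2 : K ≤ cutWeight w (Y \ X) (U \ (Y \ X)) := by
      refine h _ (Finset.sdiff_subset.trans hY) ?_ ?_
      · rw [Finset.sdiff_nonempty]
        intro hXY
        exact hX' (by rw [← hU, Finset.union_eq_left.2 hXY])
      · intro h2
        have : t ∈ Y \ X := h2 ▸ hY htY
        simp [htX] at this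
    have h3 : w t s ≤ cutWeight w (X ∩ Y) (U \ (X ∪ Y)) := by
      refine le_cutWeight w (by simp [htX, htY]) ?_
      rw [hU]; simp [hs]
    rw [hw.symm] at h3
    omega
  refine ⟨hne, ?_⟩
  have h1 := cutWeight_submodular hw.symm hXU hYU
  have h2 : K ≤ cutWeight w (X ∩ Y) (U \ (X ∩ Y)) := by
    refine h _ (Finset.inter_subset_left.trans hX) ⟨t, by simp [htX, htY]⟩ fun h2 => hX' ?_
    exact Finset.Subset.antisymm hX (h2 ▸ Finset.inter_subset_left)
  have h3 : K ≤ cutWeight w (X ∪ Y) (U \ (X ∪ Y)) :=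
    h _ (Finset.union_subset hX hY) ⟨t, by simp [htX]⟩ hne
  omega

open Classical in
/-- A vertex `s` of positive degree in an Eulerian graph has two incident edges `st`, `su` that can
be split off: no tight set contains both `t` and `u`. -/
lemma ConnectedOff.exists_splittable {w : V → V → ℕ} {U : Finset V} {s : V} {K : ℕ}
    (hw : IsEulerian w U) (hs : s ∈ U) (h : ConnectedOff w U s K)
    (hdeg : 0 < ∑ b ∈ U, w s b) :
    ∃ t ∈ U, ∃ u ∈ U, t ≠ s ∧ u ≠ s ∧
      (∀ x y, edgeWeight s t x y + edgeWeight s u x y ≤ w x y) ∧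
      ∀ X ⊆ U.erase s, X ≠ U.erase s → t ∈ X → u ∈ X → cutWeight w X (U \ X) ≠ K := by
  obtain ⟨t, htU, ht⟩ : ∃ t ∈ U, 0 < w s t := by
    by_contra! hcon
    rw [Finset.sum_eq_zero fun b hb => Nat.le_zero.1 (hcon b hb)] at hdeg
    exact lt_irrefl 0 hdeg
  have hts : t ≠ s := by rintro rfl; rw [hw.diag] at ht; exact lt_irrefl 0 ht
  have hle : ∀ u, 0 < w s u → u ≠ t → ∀ x y, edgeWeight s t x y + edgeWeight s u x y ≤ w x y := by
    intro u hu hut x y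
    have hus : u ≠ s := by rintro rfl; rw [hw.diag] at hu; exact lt_irrefl 0 hu
    have h1 := hw.symm s t
    have h2 := hw.symm s u
    unfold edgeWeight
    split_ifs with h3 h4 h4
    · grind
    · rcases h3.2 with ⟨rfl, rfl⟩ | ⟨rfl, rfl⟩ <;> omega
    · rcases h4.2 with ⟨rfl, rfl⟩ | ⟨rfl, rfl⟩ <;> omega
    · omega
  have hle' : 2 ≤ w s t → ∀ x y, edgeWeight s t x y + edgeWeight s t x y ≤ w x y := by
    intro hu x y
    have h1 := hw.symm s t
    unfold edgeWeight
    split_ifs with h3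
    · rcases h3.2 with ⟨rfl, rfl⟩ | ⟨rfl, rfl⟩ <;> omega
    · omega
  set 𝒯 : Finset (Finset V) := (U.erase s).powerset.filter fun X =>
    X ≠ U.erase s ∧ t ∈ X ∧ cutWeight w X (U \ X) = K with h𝒯
  have hmem : ∀ X, X ∈ 𝒯 ↔ X ⊆ U.erase s ∧ X ≠ U.erase s ∧ t ∈ X ∧ cutWeight w X (U \ X) = K := by
    intro X; simp [h𝒯, Finset.mem_filter, Finset.mem_powerset]
  rcases 𝒯.eq_empty_or_nonempty with hemp | hnon
  · have hnot : ∀ u, ∀ X ⊆ U.erase s, X ≠ U.erase s → t ∈ X → u ∈ X →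
        cutWeight w X (U \ X) ≠ K := by
      intro u X h1 h2 h3 _ h4
      have : X ∈ 𝒯 := (hmem X).2 ⟨h1, h2, h3, h4⟩
      simp [hemp] at this
    by_cases h2 : 2 ≤ w s t
    · exact ⟨t, htU, t, htU, hts, hts, hle' h2, hnot t⟩
    · obtain ⟨u, hu, hut, hu0⟩ : ∃ u ∈ U, u ≠ t ∧ 0 < w s u := by
        by_contra! hcon
        have hE := hw.even s hs
        rw [Finset.sum_eq_single_of_mem t htU fun b hb hbt => Nat.le_zero.1 (hcon b hb hbt)] at hE
        have : w s t = 1 := by omega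
        rw [this] at hE
        exact absurd hE (by decide)
      have hus : u ≠ s := by rintro rfl; rw [hw.diag] at hu0; exact lt_irrefl 0 hu0
      exact ⟨t, htU, u, hu, hts, hus, hle u hu0 hut, hnot u⟩
  · -- the largest tight set `X` containing `t` cannot contain all neighbours of `s`, since otherwise
    -- the complement of `X` and `s` would have a smaller cut than `X`
    obtain ⟨X, hX, hmax⟩ := Finset.exists_max_image 𝒯 Finset.card hnon
    obtain ⟨hXs, hXne, htX, hXK⟩ := (hmem X).1 hX
    have hXU := hXs.trans (Finset.erase_subset s U)
    have hsX : s ∉ X := fun h => by simpa using hXs h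
    obtain ⟨u, hu, huX, hu0⟩ : ∃ u ∈ U, u ∉ X ∧ 0 < w s u := by
      by_contra! hcon
      have h1 : K ≤ cutWeight w (U.erase s \ X) (U \ (U.erase s \ X)) := by
        refine h _ Finset.sdiff_subset ?_ ?_
        · rw [Finset.sdiff_nonempty]
          exact fun h2 => hXne (Finset.Subset.antisymm hXs h2)
        · intro h2
          have : t ∈ U.erase s \ X := by rw [h2]; exact hXs htX
          simp [htX] at this
      have h2 : U \ (U.erase s \ X) = {s} ∪ X := by
        ext a; simp only [Finset.mem_sdiff, Finset.mem_erase, Finset.mem_union,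
          Finset.mem_singleton]
        have : a ∈ X → a ∈ U := fun h => hXU h
        grind
      have h3 : cutWeight w (U.erase s \ X) {s} = 0 := by
        refine Finset.sum_eq_zero fun a ha => ?_
        simp only [Finset.mem_sdiff, Finset.mem_erase] at ha
        rw [Finset.sum_singleton, hw.symm]
        exact Nat.le_zero.1 (hcon a ha.1.2 ha.2)
      have h4 : U \ X = {s} ∪ (U.erase s \ X) := by
        ext a; simp only [Finset.mem_sdiff, Finset.mem_erase, Finset.mem_union,
          Finset.mem_singleton]
        grind
      have h5 : 0 < cutWeight w X {s} := by
        refine lt_of_lt_of_le ?_ (le_cutWeight w htX (Finset.mem_singleton_self s))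
        rwa [hw.symm]
      rw [h4, cutWeight_union_right w (by simp), cutWeight_comm hw.symm X (U.erase s \ X)] at hXK
      rw [h2, cutWeight_union_right w (by simpa using hsX), h3] at h1
      omega
    have hus : u ≠ s := by rintro rfl; rw [hw.diag] at hu0; exact lt_irrefl 0 hu0
    refine ⟨t, htU, u, hu, hts, hus, hle u hu0 (by rintro rfl; exact huX htX), ?_⟩
    intro Y hYs hYne htY huY hYK
    obtain ⟨hne, hK⟩ := h.union_tight hw hs ht hXs hYs hXne hYne htX htY hXK hYK
    have h1 := hmax (X ∪ Y) ((hmem _).2 ⟨Finset.union_subset hXs hYs, hne, by simp [htX], hK⟩)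
    have h2 := Finset.eq_of_subset_of_card_le Finset.subset_union_left h1
    exact huX (by rw [h2]; simp [huY])

open Classical in
/-- Splitting off one pair of edges at `s`. The last clause says that the cuts that ignore the edges
into a set `T` avoiding `s` do not grow. -/
lemma ConnectedOff.exists_split {w : V → V → ℕ} {U : Finset V} {s : V} {K : ℕ}
    (hw : IsEulerian w U) (hs : s ∈ U) (hK : Even K) (h : ConnectedOff w U s K)
    (hdeg : 0 < ∑ b ∈ U, w s b) :
    ∃ w' : V → V → ℕ, IsEulerian w' U ∧ ConnectedOff w' U s K ∧
      ∑ b ∈ U, w' s b < ∑ b ∈ U, w s b ∧ (∀ x y, x ≠ s → y ≠ s → w x y ≤ w' x y) ∧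
      ∀ A ⊆ U, ∀ T : Finset V, s ∉ T →
        cutWeight w' A ((U \ A) \ T) ≤ cutWeight w A ((U \ A) \ T) := by
  obtain ⟨t, htU, u, huU, hts, hus, hle, hnot⟩ := h.exists_splittable hw hs hdeg
  obtain ⟨w₀, hw₀⟩ : ∃ w₀ : V → V → ℕ,
      w = fun x y => w₀ x y + (edgeWeight s t x y + edgeWeight s u x y) :=
    ⟨fun x y => w x y - (edgeWeight s t x y + edgeWeight s u x y), by
      funext x y; have := hle x y; dsimp only; omega⟩
  have hes : ∀ a b x y : V, edgeWeight a b x y = edgeWeight a b y x := by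
    intro a b x y; unfold edgeWeight; congr 1; grind
  have hed : ∀ a b x : V, edgeWeight a b x x = 0 := by
    intro a b x; simp [edgeWeight]
  have hw₀s : ∀ a b, w₀ a b = w₀ b a := by
    intro a b
    have h1 := hw.symm a b
    rw [hw₀] at h1
    simp only [hes s t b a, hes s u b a] at h1
    omega
  have hcut : ∀ A B : Finset V, cutWeight w A B =
      cutWeight w₀ A B + (cutWeight (edgeWeight s t) A B + cutWeight (edgeWeight s u) A B) := by
    intro A B; rw [hw₀, cutWeight_add, cutWeight_add]
  refine ⟨fun x y => w₀ x y + edgeWeight t u x y, ⟨?_, ?_, ?_⟩, ?_, ?_, ?_, ?_⟩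
  · intro a b; rw [hw₀s a b, hes t u a b]
  · intro a
    have := hw.diag a
    rw [hw₀] at this
    simp only [hed] at this ⊢
    exact this
  · intro a ha
    have h1 := hw.even a ha
    rw [hw₀] at h1
    simp only [Finset.sum_add_distrib] at h1 ⊢
    rw [Nat.even_iff] at h1 ⊢
    have h2 := sum_edgeWeight_mod_two s t a hs htU
    have h3 := sum_edgeWeight_mod_two s u a hs huU
    have h4 := sum_edgeWeight_mod_two t u a htU huU
    generalize (if a = s then 1 else 0) = i at *
    generalize (if a = t then 1 else 0) = j at *
    generalize (if a = u then 1 else 0) = l at *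
    omega
  · intro X hX hXn hXne
    have h1 := h X hX hXn hXne
    have h2 := even_cutWeight_compl hw.symm hw.diag hw.even (hX.trans (Finset.erase_subset s U))
    have h3 := hnot X hX hXne
    have hsX : s ∉ X := fun h => by simpa using hX h
    have hd : Disjoint X (U \ X) := Finset.disjoint_sdiff
    rw [cutWeight_add, cutWeight_edgeWeight _ _ hd]
    rw [hcut, cutWeight_edgeWeight _ _ hd, cutWeight_edgeWeight _ _ hd] at h1 h2 h3
    rw [Nat.even_iff] at h2 hK
    by_cases htX : t ∈ X <;> by_cases huX : u ∈ X <;>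
      simp [hsX, htX, huX, hs, htU, huU] at h1 h2 h3 ⊢ <;> omega
  · rw [hw₀]
    simp only [Finset.sum_add_distrib]
    have h1 : ∑ b ∈ U, edgeWeight t u s b = 0 :=
      Finset.sum_eq_zero fun b _ => by unfold edgeWeight; rw [if_neg]; grind
    have h2 : edgeWeight s t s t ≤ ∑ b ∈ U, edgeWeight s t s b :=
      Finset.single_le_sum (f := fun b => edgeWeight s t s b) (fun _ _ => Nat.zero_le _) htU
    have h3 : edgeWeight s t s t = 1 := by simp [edgeWeight, hts.symm]
    omega
  · intro x y hx hy
    have h1 : ∀ v, edgeWeight s v x y = 0 := by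
      intro v; unfold edgeWeight; rw [if_neg]; grind
    rw [hw₀]
    simp [h1]
  · intro A hA T hT
    have hd : Disjoint A ((U \ A) \ T) :=
      Finset.disjoint_of_subset_right Finset.sdiff_subset Finset.disjoint_sdiff
    rw [cutWeight_add, hcut, cutWeight_edgeWeight _ _ hd, cutWeight_edgeWeight _ _ hd,
      cutWeight_edgeWeight _ _ hd]
    simp only [Finset.mem_sdiff, htU, huU, hs, hT, true_and, not_false_eq_true, and_true]
    by_cases h1 : t ∈ A <;> by_cases h2 : u ∈ A <;> by_cases h3 : s ∈ A <;>
      by_cases h4 : t ∈ T <;> by_cases h5 : u ∈ T <;> simp [h1, h2, h3, h4, h5]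

open Classical in
/-- Complete splitting at `s`, for an Eulerian graph. -/
lemma ConnectedOff.exists_complete_split {w : V → V → ℕ} {U : Finset V} {s : V} {K : ℕ}
    (hw : IsEulerian w U) (hs : s ∈ U) (hK : Even K) (h : ConnectedOff w U s K) :
    ∃ w' : V → V → ℕ, IsEulerian w' U ∧ ConnectedOff w' U s K ∧
      ∑ b ∈ U, w' s b = 0 ∧ (∀ x y, x ≠ s → y ≠ s → w x y ≤ w' x y) ∧
      ∀ A ⊆ U, ∀ T : Finset V, s ∉ T →
        cutWeight w' A ((U \ A) \ T) ≤ cutWeight w A ((U \ A) \ T) := by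
  induction hn : ∑ b ∈ U, w s b using Nat.strong_induction_on generalizing w with
  | _ n ih =>
    rcases Nat.eq_zero_or_pos n with h0 | hpos
    · exact ⟨w, hw, h, hn.trans h0, fun _ _ _ _ => le_rfl, fun _ _ _ _ => le_rfl⟩
    · obtain ⟨w₁, h1, h2, h3, h4, h5⟩ := h.exists_split hw hs hK (hn ▸ hpos)
      obtain ⟨w₂, g1, g2, g3, g4, g5⟩ := ih _ (hn ▸ h3) h1 h2 rfl
      exact ⟨w₂, g1, g2, g3, fun x y hx hy => (h4 x y hx hy).trans (g4 x y hx hy),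
        fun A hA T hT => (g5 A hA T hT).trans (h5 A hA T hT)⟩

open Classical in
/-- All vertices outside `U` can be split off completely. -/
theorem exists_split_all {K : ℕ} (hK : Even K) (U R : Finset V) (hUR : Disjoint U R)
    {w : V → V → ℕ} (hw : IsEulerian w (U ∪ R))
    (h : ∀ X ⊆ U ∪ R, X.Nonempty → X ≠ U ∪ R → K ≤ cutWeight w X ((U ∪ R) \ X)) :
    ∃ w' : V → V → ℕ, IsEulerian w' U ∧
      (∀ X ⊆ U, X.Nonempty → X ≠ U → K ≤ cutWeight w' X (U \ X)) ∧
      (∀ x ∈ U, ∀ y ∈ U, w x y ≤ w' x y) ∧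
      ∀ A ⊆ U ∪ R, ∀ T ⊆ U,
        cutWeight w' (A ∩ U) ((U \ A) \ T) ≤ cutWeight w A (((U ∪ R) \ A) \ T) := by
  induction R using Finset.induction_on generalizing w with
  | empty =>
    rw [Finset.union_empty] at *
    refine ⟨w, hw, h, fun _ _ _ _ => le_rfl, fun A hA T _ => ?_⟩
    rw [Finset.inter_eq_left.2 hA]
  | insert s R hsR ih =>
    rw [Finset.disjoint_insert_right] at hUR
    have hsU : s ∈ U ∪ insert s R := by simp
    have herase : (U ∪ insert s R).erase s = U ∪ R := by
      rw [Finset.union_insert, Finset.erase_insert]; simp [hUR.1, hsR]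
    have hsub : U ∪ R ⊆ U ∪ insert s R := herase ▸ Finset.erase_subset _ _
    have hsn : s ∉ U ∪ R := by simp [hUR.1, hsR]
    have hoff : ConnectedOff w (U ∪ insert s R) s K := by
      intro X hX hXn _
      refine h X (hX.trans (Finset.erase_subset _ _)) hXn ?_
      rintro rfl
      simpa using hX hsU
    obtain ⟨w₁, h1, h2, h3, h4, h5⟩ := hoff.exists_complete_split hw hsU hK
    have hz : ∀ b ∈ U ∪ insert s R, w₁ s b = 0 := fun b hb =>
      (Finset.sum_eq_zero_iff.1 h3) b hb
    have hU' : U ∪ insert s R = insert s (U ∪ R) := by rw [Finset.union_insert]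
    have hw₁ : IsEulerian w₁ (U ∪ R) := by
      refine ⟨h1.symm, h1.diag, fun a ha => ?_⟩
      have := h1.even a (hsub ha)
      rwa [hU', Finset.sum_insert hsn, h1.symm a s, hz a (hsub ha), zero_add] at this
    obtain ⟨w₂, g1, g2, g3, g4⟩ := ih hUR.2 hw₁ (fun X hX hXn hXne => by
      have e1 := h2 X (by rwa [herase]) hXn (by rwa [herase])
      have hsX : s ∉ X := fun hs => hsn (hX hs)
      have e2 : (U ∪ insert s R) \ X = {s} ∪ ((U ∪ R) \ X) := by
        ext a
        simp only [hU', Finset.mem_sdiff, Finset.mem_insert, Finset.mem_union,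
          Finset.mem_singleton]
        grind
      have e3 : cutWeight w₁ X {s} = 0 := Finset.sum_eq_zero fun a ha => by
        rw [Finset.sum_singleton, h1.symm]; exact hz a (hsub (hX ha))
      rw [e2, cutWeight_union_right w₁ (by simp [hUR.1, hsR]), e3, zero_add] at e1
      exact e1)
    refine ⟨w₂, g1, g2, fun x hx y hy => ?_, fun A hA T hT => ?_⟩
    · exact (h4 x y (by rintro rfl; exact hUR.1 hx) (by rintro rfl; exact hUR.1 hy)).trans
        (g3 x hx y hy)
    · have hsT : s ∉ T := fun h => hUR.1 (hT h)
      have e1 := g4 (A.erase s) (by rw [← herase]; exact Finset.erase_subset_erase _ hA) T hT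
      have e2 := h5 A hA T hsT
      have e3 : A.erase s ∩ U = A ∩ U := by
        ext a; simp only [Finset.mem_inter, Finset.mem_erase]
        grind
      have e4 : (U \ A.erase s) = U \ A := by
        ext a; simp only [Finset.mem_sdiff, Finset.mem_erase]
        grind
      rw [e3, e4] at e1
      refine e1.trans (le_trans (cutWeight_mono _ (Finset.erase_subset _ _) ?_) e2)
      intro a ha
      simp only [Finset.mem_sdiff, Finset.mem_erase, Finset.mem_union, Finset.mem_insert] at ha ⊢
      grind

end Splitting

/-! ### Sparse weights and orientations of bounded out-degree -/

section Sparse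

variable {V : Type*}

open Classical in
/-- Weights inside `N` can be lowered, keeping all cuts around subsets of `N` at least `K`, until any
two adjacent vertices of `N` are separated by a tight set. -/
lemma exists_minimal_weight {N : Finset V} {c : V} {K : ℕ} (hc : c ∉ N) {w : V → V → ℕ}
    (hs : ∀ a b, w a b = w b a) (hd : ∀ a, w a a = 0)
    (h : ∀ A ⊆ N, A.Nonempty → K ≤ cutWeight w A (insert c N \ A)) :
    ∃ w' : V → V → ℕ, (∀ a b, w' a b = w' b a) ∧ (∀ a, w' a a = 0) ∧
      (∀ a b, w' a b ≤ w a b) ∧ (∀ a, w' a c = w a c) ∧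
      (∀ A ⊆ N, A.Nonempty → K ≤ cutWeight w' A (insert c N \ A)) ∧
      ∀ x ∈ N, ∀ y ∈ N, 0 < w' x y →
        ∃ A ⊆ N, (x ∈ A ↔ y ∉ A) ∧ cutWeight w' A (insert c N \ A) = K := by
  induction hn : cutWeight w N N using Nat.strong_induction_on generalizing w with
  | _ n ih =>
    by_cases hall : ∀ x ∈ N, ∀ y ∈ N, 0 < w x y →
        ∃ A ⊆ N, (x ∈ A ↔ y ∉ A) ∧ cutWeight w A (insert c N \ A) = K
    · exact ⟨w, hs, hd, fun _ _ => le_rfl, fun _ => rfl, h, hall⟩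
    push Not at hall
    obtain ⟨x, hx, y, hy, hxy, hno⟩ := hall
    have hne : x ≠ y := by rintro rfl; rw [hd] at hxy; exact lt_irrefl 0 hxy
    have hes : ∀ a b : V, edgeWeight x y a b = edgeWeight x y b a := by
      intro a b; unfold edgeWeight; congr 1; grind
    have hle : ∀ a b, edgeWeight x y a b ≤ w a b := by
      intro a b
      have := hs x y
      unfold edgeWeight
      split_ifs with h1
      · rcases h1.2 with ⟨rfl, rfl⟩ | ⟨rfl, rfl⟩ <;> omega
      · omega
    obtain ⟨w₀, hw₀⟩ : ∃ w₀ : V → V → ℕ, w = fun a b => w₀ a b + edgeWeight x y a b :=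
      ⟨fun a b => w a b - edgeWeight x y a b, by
        funext a b; have := hle a b; dsimp only; omega⟩
    have hwab : ∀ a b, w a b = w₀ a b + edgeWeight x y a b := fun a b => by rw [hw₀]
    have hcut : ∀ A B : Finset V, cutWeight w A B =
        cutWeight w₀ A B + cutWeight (edgeWeight x y) A B := by
      intro A B; rw [hw₀, cutWeight_add]
    have hs₀ : ∀ a b, w₀ a b = w₀ b a := by
      intro a b
      have h1 := hs a b
      rw [hwab, hwab, hes b a] at h1
      omega
    obtain ⟨w', g1, g2, g3, g4, g5, g6⟩ := ih (cutWeight w₀ N N) (by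
        have h1 : edgeWeight x y x y ≤ cutWeight (edgeWeight x y) N N := le_cutWeight _ hx hy
        have h2 : edgeWeight x y x y = 1 := by simp [edgeWeight, hne]
        have h3 := hcut N N
        omega) hs₀ (fun a => by have := hwab a a; rw [hd] at this; omega)
      (fun A hA hAn => by
        have h1 := h A hA hAn
        have h2 := hno A hA
        have hcA : c ∉ A := fun h => hc (hA h)
        rw [hcut, cutWeight_edgeWeight _ _ Finset.disjoint_sdiff] at h1 h2
        by_cases hxA : x ∈ A <;> by_cases hyA : y ∈ A <;> simp [hxA, hyA, hx, hy] at h1 h2 ⊢ <;>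
          omega) rfl
    refine ⟨w', g1, g2, fun a b => (g3 a b).trans (by rw [hwab]; omega), fun a => ?_, g5, g6⟩
    rw [g4, hwab]
    have : edgeWeight x y a c = 0 := by
      unfold edgeWeight; rw [if_neg]; rintro ⟨-, ⟨-, rfl⟩ | ⟨-, rfl⟩⟩ <;> exact hc ‹_›
    omega

open Classical in
/-- If any two adjacent vertices are separated by a cut of weight `K`, then `X` spans total weight at
most `K (|X| - 1)`; here each edge is counted twice. -/
lemma cutWeight_self_add_le {N : Finset V} {c : V} {K : ℕ} {w : V → V → ℕ}
    (hs : ∀ a b, w a b = w b a)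
    (h : ∀ x ∈ N, ∀ y ∈ N, 0 < w x y →
        ∃ A ⊆ N, (x ∈ A ↔ y ∉ A) ∧ cutWeight w A (insert c N \ A) = K)
    {X : Finset V} (hX : X ⊆ N) (hne : X.Nonempty) :
    cutWeight w X X + 2 * K ≤ 2 * K * X.card := by
  induction hn : X.card using Nat.strong_induction_on generalizing X with
  | _ n ih =>
    by_cases h0 : ∀ x ∈ X, ∀ y ∈ X, w x y = 0
    · have : cutWeight w X X = 0 := Finset.sum_eq_zero fun x hx => Finset.sum_eq_zero (h0 x hx)
      have := Finset.card_pos.2 hne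
      nlinarith
    push Not at h0
    obtain ⟨x, hx, y, hy, hxy⟩ := h0
    obtain ⟨A, hA, hsep, hAK⟩ := h x (hX hx) y (hX hy) (Nat.pos_of_ne_zero hxy)
    have e1 : X = X ∩ A ∪ X \ A := by rw [Finset.union_comm, Finset.sdiff_union_inter]
    have hd : Disjoint (X ∩ A) (X \ A) := Finset.disjoint_of_subset_left
      Finset.inter_subset_right Finset.disjoint_sdiff
    have hcard : (X ∩ A).card + (X \ A).card = X.card := Finset.card_inter_add_card_sdiff X A
    have n1 : (X ∩ A).Nonempty := by
      by_cases hxA : x ∈ A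
      · exact ⟨x, by simp [hx, hxA]⟩
      · exact ⟨y, by simp [hy]; tauto⟩
    have n2 : (X \ A).Nonempty := by
      by_cases hxA : x ∈ A
      · exact ⟨y, by simp [hy]; tauto⟩
      · exact ⟨x, by simp [hx, hxA]⟩
    have p1 := Finset.card_pos.2 n1
    have p2 := Finset.card_pos.2 n2
    have i1 := ih _ (by omega) (Finset.inter_subset_left.trans hX) n1 rfl
    have i2 := ih _ (by omega) (Finset.sdiff_subset.trans hX) n2 rfl
    have i3 : cutWeight w (X ∩ A) (X \ A) ≤ K := by
      rw [← hAK]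
      exact cutWeight_mono w Finset.inter_subset_right
        (Finset.sdiff_subset_sdiff (hX.trans (Finset.subset_insert c N)) subset_rfl)
    have e2 : cutWeight w X X = cutWeight w (X ∩ A) (X ∩ A) + cutWeight w (X \ A) (X \ A) +
        2 * cutWeight w (X ∩ A) (X \ A) := by
      conv_lhs => rw [e1]
      rw [cutWeight_union_left w hd, cutWeight_union_right w hd, cutWeight_union_right w hd,
        cutWeight_comm hs (X \ A) (X ∩ A)]
      ring
    rw [← hn, ← hcard, e2]
    nlinarith

/-- A degenerate weighted graph has an orientation of bounded out-degree; `O x` is the set of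
out-neighbours of `x`. -/
lemma exists_orientation {p : ℕ} {w : V → V → ℕ} (hs : ∀ a b, w a b = w b a) (N : Finset V)
    (h : ∀ X ⊆ N, X.Nonempty → ∃ x ∈ X, ∑ y ∈ X, w x y ≤ p) :
    ∃ O : V → Finset V, (∀ x ∈ N, O x ⊆ N ∧ (O x).card ≤ p ∧ ∀ y ∈ O x, 0 < w x y) ∧
      ∀ x ∈ N, ∀ y ∈ N, 0 < w x y → y ∈ O x ∨ x ∈ O y := by
  classical
  induction hn : N.card generalizing N with
  | zero =>
    rw [Finset.card_eq_zero.1 hn]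
    exact ⟨fun _ => ∅, by simp, by simp⟩
  | succ n ih =>
    obtain ⟨x, hx, hdeg⟩ := h N subset_rfl (Finset.card_pos.1 (by omega))
    obtain ⟨O, h1, h2⟩ := ih (N.erase x)
      (fun X hX => h X (hX.trans (Finset.erase_subset _ _)))
      (by rw [Finset.card_erase_of_mem hx]; omega)
    refine ⟨Function.update O x (N.filter fun y => 0 < w x y), ?_, ?_⟩
    · intro y hy
      by_cases hyx : y = x
      · subst hyx
        rw [Function.update_self]
        refine ⟨Finset.filter_subset _ _, le_trans ?_ hdeg, by simp⟩
        rw [Finset.card_filter]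
        refine Finset.sum_le_sum fun z _ => ?_
        split_ifs <;> omega
      · rw [Function.update_of_ne hyx]
        obtain ⟨g1, g2⟩ := h1 y (Finset.mem_erase.2 ⟨hyx, hy⟩)
        exact ⟨g1.trans (Finset.erase_subset _ _), g2⟩
    · intro y hy z hz hyz
      by_cases hyx : y = x
      · subst hyx
        left; simp [hz, hyz]
      by_cases hzx : z = x
      · subst hzx
        right; simp [hy, hs z y, hyz]
      rw [Function.update_of_ne hyx, Function.update_of_ne hzx]
      exact h2 y (Finset.mem_erase.2 ⟨hyx, hy⟩) z (Finset.mem_erase.2 ⟨hzx, hz⟩) hyz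

end Sparse

/-! ### Bounded walks, groups and independent choices -/

section Walks

variable {V : Type*}

/-- There is a walk of at most `n` steps of `r` from `a` to `b`. -/
def Within (r : V → V → Prop) : ℕ → V → V → Prop
  | 0, a, b => a = b
  | n + 1, a, b => ∃ x, Within r n a x ∧ (x = b ∨ r x b)

lemma Within.refl (r : V → V → Prop) (n : ℕ) (a : V) : Within r n a a := by
  induction n with
  | zero => rfl
  | succ n ih => exact ⟨a, ih, Or.inl rfl⟩

lemma Within.mono {r : V → V → Prop} {m n : ℕ} (h : m ≤ n) {a b : V} (hab : Within r m a b) :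
    Within r n a b := by
  induction n, h using Nat.le_induction with
  | base => exact hab
  | succ n _ ih => exact ⟨b, ih, Or.inl rfl⟩

lemma Within.imp {r r' : V → V → Prop} (h : ∀ x y, r x y → r' x y) {n : ℕ} {a b : V}
    (hab : Within r n a b) : Within r' n a b := by
  induction n generalizing b with
  | zero => exact hab
  | succ n ih =>
    obtain ⟨x, hx, hxb⟩ := hab
    exact ⟨x, ih hx, hxb.imp id (h x b)⟩

lemma Within.head {r : V → V → Prop} {n : ℕ} {a b x : V} (hax : a = x ∨ r a x)
    (hxb : Within r n x b) : Within r (n + 1) a b := by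
  induction n generalizing b with
  | zero => exact ⟨a, rfl, hxb ▸ hax⟩
  | succ n ih =>
    obtain ⟨y, hy, hyb⟩ := hxb
    exact ⟨y, ih hy, hyb⟩

lemma Within.symm {r : V → V → Prop} (hr : ∀ x y, r x y → r y x) {n : ℕ} {a b : V}
    (hab : Within r n a b) : Within r n b a := by
  induction n generalizing b with
  | zero => exact Eq.symm hab
  | succ n ih =>
    obtain ⟨x, hx, hxb⟩ := hab
    exact Within.head (hxb.imp Eq.symm (hr x b)) (ih hx)

lemma Within.mem {r : V → V → Prop} {S : Set V} (hr : ∀ x y, r x y → y ∈ S) {n : ℕ} {a b : V}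
    (ha : a ∈ S) (hab : Within r n a b) : b ∈ S := by
  induction n generalizing b with
  | zero => exact hab ▸ ha
  | succ n ih =>
    obtain ⟨x, hx, rfl | hxb⟩ := hab
    · exact ih hx
    · exact hr x b hxb

/-- Composing relations multiplies the bounds on the numbers of successors. -/
lemma card_filter_comp_le {S S' : Finset V} (R Q : V → V → Prop) {p q : ℕ} {a : V}
    [DecidablePred (R a)] [∀ b, DecidablePred (Q b)] [DecidablePred fun x => ∃ b ∈ S, R a b ∧ Q b x]
    (h1 : (S.filter (R a)).card ≤ p) (h2 : ∀ b ∈ S, (S'.filter (Q b)).card ≤ q) :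
    (S'.filter fun x => ∃ b ∈ S, R a b ∧ Q b x).card ≤ p * q := by
  classical
  have hsub : (S'.filter fun x => ∃ b ∈ S, R a b ∧ Q b x) ⊆
      (S.filter (R a)).biUnion fun b => S'.filter (Q b) := by
    intro x
    simp only [Finset.mem_filter, Finset.mem_biUnion]
    rintro ⟨hx, b, hb, hR, hQ⟩
    exact ⟨b, ⟨hb, hR⟩, hx, hQ⟩
  refine (Finset.card_le_card hsub).trans
    ((Finset.card_biUnion_le_card_mul _ _ q fun b hb => ?_).trans (Nat.mul_le_mul_right q h1))
  exact h2 b (Finset.mem_filter.1 hb).1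

open Classical in
lemma card_within_le {r : V → V → Prop} {S : Finset V} {q : ℕ}
    (h : ∀ b ∈ S, (S.filter (r b)).card ≤ q) (hr : ∀ x y, r x y → y ∈ S) {a : V} (ha : a ∈ S)
    (n : ℕ) : (S.filter (Within r n a)).card ≤ (q + 1) ^ n := by
  induction n with
  | zero =>
    rw [pow_zero, Finset.card_le_one]
    intro x hx y hy
    have h1 : a = x := (Finset.mem_filter.1 hx).2
    have h2 : a = y := (Finset.mem_filter.1 hy).2
    exact h1.symm.trans h2
  | succ n ih =>
    have h1 : ∀ b ∈ S, (S.filter fun x => b = x ∨ r b x).card ≤ q + 1 := by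
      intro b hb
      refine (Finset.card_le_card (t := insert b (S.filter (r b))) ?_).trans
        ((Finset.card_insert_le _ _).trans (Nat.succ_le_succ (h b hb)))
      intro x
      simp only [Finset.mem_filter, Finset.mem_insert]
      rintro ⟨hx, rfl | hbx⟩
      · exact Or.inl rfl
      · exact Or.inr ⟨hx, hbx⟩
    rw [pow_succ]
    refine le_trans (Finset.card_le_card ?_) (card_filter_comp_le (Within r n)
      (fun b x => b = x ∨ r b x) ih h1)
    intro x
    simp only [Finset.mem_filter]
    rintro ⟨hx, b, hb, hbx⟩
    exact ⟨hx, b, Within.mem (S := (S : Set V)) hr ha hb, hb, hbx⟩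

open Classical in
/-- Either the balls around `a` keep growing, or one of them is closed under `r`. -/
lemma Within.growth {r : V → V → Prop} {S : Finset V} (hr : ∀ x y, r x y → y ∈ S) {a : V}
    (ha : a ∈ S) (n : ℕ) :
    n + 1 ≤ (S.filter (Within r n a)).card ∨
      ∃ i ≤ n, ∀ x y, Within r i a x → r x y → Within r i a y := by
  induction n with
  | zero =>
    left
    exact Finset.card_pos.2 ⟨a, Finset.mem_filter.2 ⟨ha, rfl⟩⟩
  | succ n ih =>
    rcases ih with ih | ⟨i, hi, h⟩
    · have hsub : S.filter (Within r n a) ⊆ S.filter (Within r (n + 1) a) :=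
        Finset.monotone_filter_right _ fun x _ hx => Within.mono n.le_succ hx
      rcases hsub.eq_or_ssubset with heq | hss
      · right
        refine ⟨n, n.le_succ, fun x y hx hxy => ?_⟩
        have : y ∈ S.filter (Within r (n + 1) a) :=
          Finset.mem_filter.2 ⟨hr x y hxy, x, hx, Or.inr hxy⟩
        rw [← heq] at this
        exact (Finset.mem_filter.1 this).2
      · left
        have := Finset.card_lt_card hss
        omega
    · exact Or.inr ⟨i, hi.trans n.le_succ, h⟩

open Classical in
/-- A set of at least `m` elements splits into groups of between `m` and `2 * m` elements. The group
of `y` is recorded by `g y`, and labels of groups are also given to elements outside the set. -/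
lemma exists_groups {m : ℕ} (hm : 0 < m) (S : Finset V) (h : m ≤ S.card) :
    ∃ g : V → ℕ, ∀ x, m ≤ (S.filter fun y => g y = g x).card ∧
      (S.filter fun y => g y = g x).card ≤ 2 * m := by
  induction hn : S.card using Nat.strong_induction_on generalizing S with
  | _ n ih =>
    by_cases h2 : S.card ≤ 2 * m
    · exact ⟨fun _ => 0, fun x => by simpa using ⟨h, h2⟩⟩
    obtain ⟨S₁, hS₁, hcard⟩ := Finset.exists_subset_card_eq h
    have hc := Finset.card_sdiff_add_card_eq_card hS₁
    obtain ⟨g, hg⟩ := ih (S \ S₁).card (by omega) (S \ S₁) (by omega) rfl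
    refine ⟨fun x => if x ∈ S₁ then 0 else g x + 1, fun x => ?_⟩
    by_cases hx : x ∈ S₁
    · have : (S.filter fun y => (if y ∈ S₁ then 0 else g y + 1) =
          if x ∈ S₁ then 0 else g x + 1) = S₁ := by
        ext y
        simp only [Finset.mem_filter, hx, if_true]
        constructor
        · rintro ⟨-, hy⟩
          by_contra hyS
          simp [hyS] at hy
        · intro hy
          exact ⟨hS₁ hy, by simp [hy]⟩
      rw [this, hcard]
      omega
    · have : (S.filter fun y => (if y ∈ S₁ then 0 else g y + 1) =
          if x ∈ S₁ then 0 else g x + 1) = (S \ S₁).filter fun y => g y = g x := by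
        ext y
        simp only [Finset.mem_filter, hx, if_false, Finset.mem_sdiff]
        by_cases hy : y ∈ S₁ <;> simp [hy]
      rw [this]
      exact hg x

open Classical in
/-- Greedy choice of `n` elements that are pairwise not in the relation `R`. -/
lemma exists_pairwise_not {R : V → V → Prop} (hsymm : ∀ x y, R x y → R y x) {L : Finset V} {C : ℕ}
    (hC : ∀ a ∈ L, (L.filter (R a)).card ≤ C) (hrefl : ∀ a ∈ L, R a a) (hC0 : 0 < C) (n : ℕ)
    (hn : C * n ≤ L.card) :
    ∃ T ⊆ L, T.card = n ∧ ∀ a ∈ T, ∀ b ∈ T, a ≠ b → ¬ R a b := by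
  induction n with
  | zero => exact ⟨∅, by simp⟩
  | succ n ih =>
    obtain ⟨T, hT, hTn, hTR⟩ := ih (by rw [Nat.mul_succ] at hn; omega)
    have hlt : (T.biUnion fun a => L.filter (R a)).card < L.card := by
      refine (Finset.card_biUnion_le_card_mul _ _ C fun a ha => hC a (hT ha)).trans_lt ?_
      rw [hTn, mul_comm]
      rw [Nat.mul_succ] at hn
      omega
    obtain ⟨x, hx, hxT⟩ := Finset.exists_mem_notMem_of_card_lt_card hlt
    simp only [Finset.mem_biUnion, Finset.mem_filter, not_exists, not_and] at hxT
    have hno : ∀ a ∈ T, ¬ R a x := fun a ha => hxT a ha hx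
    have hxT' : x ∉ T := fun h => hno x h (hrefl x hx)
    refine ⟨insert x T, Finset.insert_subset hx hT, by rw [Finset.card_insert_of_notMem hxT', hTn],
      fun a ha b hb hab hR => ?_⟩
    rcases Finset.mem_insert.1 ha with hax | haT <;> rcases Finset.mem_insert.1 hb with hbx | hbT
    · exact hab (hax.trans hbx.symm)
    · exact hno b hbT (hsymm _ _ (hax ▸ hR))
    · exact hno a haT (hbx ▸ hR)
    · exact hTR a haT b hbT hab hR

end Walks

/-! ### Terminals with disjoint zones -/

section Zones

variable {V : Type*}

open Classical in
/-- An orientation of the graph of positive weights on `N` with out-degrees at most `4 * k`, together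
with a partition, for each vertex of large in-degree, of its in-neighbours into groups. -/
structure Grouping (w : V → V → ℕ) (N : Finset V) (k : ℕ) where
  /-- the out-neighbours of a vertex -/
  out : V → Finset V
  out_subset : ∀ x ∈ N, out x ⊆ N
  card_out_le : ∀ x ∈ N, (out x).card ≤ 4 * k
  pos_of_mem_out : ∀ x ∈ N, ∀ y ∈ out x, 0 < w x y
  mem_out_or : ∀ x ∈ N, ∀ y ∈ N, 0 < w x y → y ∈ out x ∨ x ∈ out y
  /-- `group v y` is the label of the group of `y` at the vertex `v`; every vertex, whether or not it
  is an in-neighbour of `v`, carries the label of some group -/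
  group : V → V → ℕ
  card_group : ∀ v ∈ N, 8 * k ≤ (N.filter fun x => v ∈ out x).card → ∀ x,
    2 * k ≤ ((N.filter fun y => v ∈ out y).filter fun y => group v y = group v x).card ∧
      ((N.filter fun y => v ∈ out y).filter fun y => group v y = group v x).card ≤ 2 * (2 * k)

namespace Grouping

variable {w : V → V → ℕ} {N : Finset V} {k : ℕ} (Γ : Grouping w N k)

open Classical in
/-- The in-neighbours of `v`. -/
noncomputable def ins (v : V) : Finset V := N.filter fun x => v ∈ Γ.out x

open Classical in
/-- The vertices of large in-degree. -/
noncomputable def high : Finset V := N.filter fun v => 8 * k ≤ (Γ.ins v).card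

open Classical in
/-- The vertices of small in-degree; they have boundedly many neighbours. -/
noncomputable def low : Finset V := N \ Γ.high

/-- Adjacency between low vertices. -/
def LowStep (x y : V) : Prop := x ∈ Γ.low ∧ y ∈ Γ.low ∧ 0 < w x y

/-- `y` is `x`, or `y` lies in the group that `x` belongs to at some high neighbour of `x`. -/
def Attached (x y : V) : Prop :=
  x = y ∨ ∃ v ∈ Γ.high, 0 < w v x ∧ y ∈ Γ.ins v ∧ Γ.group v y = Γ.group v x

/-- `y` is in the zone of `t`: it is attached to a vertex that can be reached from `t` in at most `k`
steps through low vertices. -/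
def Near (t y : V) : Prop := ∃ x ∈ Γ.low, Within Γ.LowStep k t x ∧ Γ.Attached x y

lemma mem_ins {v x : V} : x ∈ Γ.ins v ↔ x ∈ N ∧ v ∈ Γ.out x := by simp [ins]

lemma mem_low {x : V} : x ∈ Γ.low ↔ x ∈ N ∧ x ∉ Γ.high := by simp [low]

lemma mem_high {x : V} : x ∈ Γ.high ↔ x ∈ N ∧ 8 * k ≤ (Γ.ins x).card := by simp [high]

lemma lowStep_symm (hs : ∀ a b, w a b = w b a) (x y : V) (h : Γ.LowStep x y) : Γ.LowStep y x :=
  ⟨h.2.1, h.1, hs x y ▸ h.2.2⟩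

lemma near_self {t : V} (ht : t ∈ Γ.low) : Γ.Near t t :=
  ⟨t, ht, Within.refl _ _ _, Or.inl rfl⟩

open Classical in
lemma card_le_two_mul_card_low (hk : 0 < k) : N.card ≤ 2 * Γ.low.card := by
  have h1 : ∑ v ∈ N, (Γ.ins v).card ≤ N.card * (4 * k) := by
    have : ∑ v ∈ N, (Γ.ins v).card = ∑ x ∈ N, (N.filter fun v => v ∈ Γ.out x).card := by
      simp only [ins, Finset.card_filter]
      exact Finset.sum_comm
    rw [this, ← smul_eq_mul]
    refine Finset.sum_le_card_nsmul _ _ _ fun x hx => le_trans (Finset.card_le_card ?_)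
      (Γ.card_out_le x hx)
    intro v; simp
  have h2 : Γ.high.card * (8 * k) ≤ ∑ v ∈ Γ.high, (Γ.ins v).card := by
    rw [← smul_eq_mul]
    exact Finset.card_nsmul_le_sum _ _ _ fun v hv => (Γ.mem_high.1 hv).2
  have hsub : Γ.high ⊆ N := Finset.filter_subset _ _
  have h3 : ∑ v ∈ Γ.high, (Γ.ins v).card ≤ ∑ v ∈ N, (Γ.ins v).card :=
    Finset.sum_le_sum_of_subset hsub
  have h4 : Γ.low.card + Γ.high.card = N.card := Finset.card_sdiff_add_card_eq_card hsub
  have h5 : 2 * Γ.high.card ≤ N.card := by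
    by_contra! h
    have : k * N.card < k * (2 * Γ.high.card) := Nat.mul_lt_mul_of_pos_left h hk
    nlinarith
  omega

open Classical in
/-- A low vertex has at most `12 * k` neighbours in `N`. -/
lemma card_neighbours_low_le {x : V} (hx : x ∈ Γ.low) :
    (N.filter fun y => 0 < w x y).card ≤ 12 * k := by
  obtain ⟨hxN, hxH⟩ := Γ.mem_low.1 hx
  have h1 : (Γ.ins x).card ≤ 8 * k := by
    by_contra! h
    exact hxH (Γ.mem_high.2 ⟨hxN, h.le⟩)
  have h2 := Γ.card_out_le x hxN
  have hsub : (N.filter fun y => 0 < w x y) ⊆ Γ.out x ∪ Γ.ins x := by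
    intro y
    simp only [Finset.mem_filter, Finset.mem_union, Γ.mem_ins]
    rintro ⟨hy, hxy⟩
    rcases Γ.mem_out_or x hxN y hy hxy with h | h
    · exact Or.inl h
    · exact Or.inr ⟨hy, h⟩
  have := Finset.card_le_card hsub
  have := Finset.card_union_le (Γ.out x) (Γ.ins x)
  omega

open Classical in
lemma card_attached_le (hs : ∀ a b, w a b = w b a) {x : V} (hx : x ∈ Γ.low) :
    (N.filter (Γ.Attached x)).card ≤ 1 + 12 * k * (4 * k) := by
  have hsub : N.filter (Γ.Attached x) ⊆ {x} ∪ N.filter fun y => ∃ v ∈ Γ.high,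
      0 < w x v ∧ (y ∈ Γ.ins v ∧ Γ.group v y = Γ.group v x) := by
    intro y
    simp only [Finset.mem_filter, Finset.mem_union, Finset.mem_singleton]
    rintro ⟨hy, rfl | ⟨v, hv, hw, h⟩⟩
    · exact Or.inl rfl
    · exact Or.inr ⟨hy, v, hv, hs v x ▸ hw, h⟩
  refine (Finset.card_le_card hsub).trans ((Finset.card_union_le _ _).trans ?_)
  rw [Finset.card_singleton]
  refine Nat.add_le_add_left (card_filter_comp_le (fun x v => 0 < w x v)
    (fun v y => y ∈ Γ.ins v ∧ Γ.group v y = Γ.group v x) ?_ ?_) 1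
  · refine le_trans (Finset.card_le_card ?_) (Γ.card_neighbours_low_le hx)
    intro v
    simp only [Finset.mem_filter, Γ.mem_high]
    exact fun h => ⟨h.1.1, h.2⟩
  · intro v hv
    obtain ⟨hvN, hv8⟩ := Γ.mem_high.1 hv
    have h2 := (Γ.card_group v hvN hv8 x).2
    refine le_trans (Finset.card_le_card ?_) (h2.trans (by omega))
    intro y
    simp only [Finset.mem_filter, Γ.mem_ins]
    tauto

open Classical in
lemma card_attached_symm_le {y : V} (hy : y ∈ N) :
    (Γ.low.filter fun x => Γ.Attached x y).card ≤ 1 + 4 * k * (8 * k) := by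
  have hsub : (Γ.low.filter fun x => Γ.Attached x y) ⊆ {y} ∪ Γ.low.filter fun x => ∃ v ∈ Γ.high,
      v ∈ Γ.out y ∧ (0 < w v x ∧ Γ.group v y = Γ.group v x) := by
    intro x
    simp only [Finset.mem_filter, Finset.mem_union, Finset.mem_singleton]
    rintro ⟨hx, rfl | ⟨v, hv, hw, h, h'⟩⟩
    · exact Or.inl rfl
    · exact Or.inr ⟨hx, v, hv, (Γ.mem_ins.1 h).2, hw, h'⟩
  refine (Finset.card_le_card hsub).trans ((Finset.card_union_le _ _).trans ?_)
  rw [Finset.card_singleton]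
  refine Nat.add_le_add_left (card_filter_comp_le (fun y v => v ∈ Γ.out y)
    (fun v x => 0 < w v x ∧ Γ.group v y = Γ.group v x) ?_ ?_) 1
  · refine le_trans (Finset.card_le_card ?_) (Γ.card_out_le y hy)
    intro v
    simp only [Finset.mem_filter]
    exact fun h => h.2
  · intro v hv
    obtain ⟨hvN, hv8⟩ := Γ.mem_high.1 hv
    have h2 := (Γ.card_group v hvN hv8 y).2
    have h3 := Γ.card_out_le v hvN
    have hsub : (Γ.low.filter fun x => 0 < w v x ∧ Γ.group v y = Γ.group v x) ⊆
        ((N.filter fun x => v ∈ Γ.out x).filter fun x => Γ.group v x = Γ.group v y) ∪ Γ.out v := by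
      intro x
      simp only [Finset.mem_filter, Finset.mem_union, Γ.mem_low]
      rintro ⟨⟨hx, -⟩, hvx, hg⟩
      rcases Γ.mem_out_or v hvN x hx hvx with h | h
      · exact Or.inr h
      · exact Or.inl ⟨⟨hx, h⟩, hg.symm⟩
    have h4 := Finset.card_le_card hsub
    have h5 := Finset.card_union_le ((N.filter fun x => v ∈ Γ.out x).filter
      fun x => Γ.group v x = Γ.group v y) (Γ.out v)
    refine le_trans (le_of_eq ?_) (h4.trans (h5.trans (by omega : _ ≤ 8 * k)))
    congr

open Classical in
/-- A low vertex shares nearby vertices with a bounded number of low vertices only. -/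
lemma card_conflict_le (hs : ∀ a b, w a b = w b a) {t : V} (ht : t ∈ Γ.low) :
    (Γ.low.filter fun u => ∃ y ∈ N, Γ.Near t y ∧ Γ.Near u y).card ≤
      (12 * k + 1) ^ k * ((1 + 12 * k * (4 * k)) * ((1 + 4 * k * (8 * k)) * (12 * k + 1) ^ k)) := by
  have hball : ∀ a ∈ Γ.low, (Γ.low.filter (Within Γ.LowStep k a)).card ≤ (12 * k + 1) ^ k := by
    intro a ha
    refine card_within_le (fun b hb => ?_) (fun x y h => h.2.1) ha k
    refine le_trans (Finset.card_le_card ?_) (Γ.card_neighbours_low_le hb)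
    intro y
    simp only [Finset.mem_filter]
    exact fun h => ⟨(Γ.mem_low.1 h.1).1, h.2.2.2⟩
  have h1 : ∀ x' ∈ Γ.low, (Γ.low.filter (Within Γ.LowStep k x')).card ≤ (12 * k + 1) ^ k := hball
  have h2 : ∀ y ∈ N, (Γ.low.filter fun u => ∃ x' ∈ Γ.low, Γ.Attached x' y ∧
      Within Γ.LowStep k x' u).card ≤ (1 + 4 * k * (8 * k)) * (12 * k + 1) ^ k := by
    intro y hy
    exact card_filter_comp_le (fun y x' => Γ.Attached x' y) (Within Γ.LowStep k)
      (Γ.card_attached_symm_le hy) h1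
  have h3 : ∀ x ∈ Γ.low, (Γ.low.filter fun u => ∃ y ∈ N, Γ.Attached x y ∧ ∃ x' ∈ Γ.low,
      Γ.Attached x' y ∧ Within Γ.LowStep k x' u).card ≤
      (1 + 12 * k * (4 * k)) * ((1 + 4 * k * (8 * k)) * (12 * k + 1) ^ k) := by
    intro x hx
    exact card_filter_comp_le Γ.Attached
      (fun y u => ∃ x' ∈ Γ.low, Γ.Attached x' y ∧ Within Γ.LowStep k x' u)
      (Γ.card_attached_le hs hx) h2
  have h4 := card_filter_comp_le (Within Γ.LowStep k)
      (fun x u => ∃ y ∈ N, Γ.Attached x y ∧ ∃ x' ∈ Γ.low,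
        Γ.Attached x' y ∧ Within Γ.LowStep k x' u) (hball t ht) h3
  refine le_trans (Finset.card_le_card ?_) h4
  intro u
  simp only [Finset.mem_filter]
  rintro ⟨hu, y, hy, ⟨x, hx, hx1, hx2⟩, ⟨x', hx', hx1', hx2'⟩⟩
  exact ⟨hu, x, hx, hx1, y, hy, hx2, x', hx', hx2', hx1'.symm (Γ.lowStep_symm hs)⟩

open Classical in
/-- The edges credited to the terminal `t` in the cut between `A` and `B`. -/
noncomputable def credit (c : V) (A B : Finset V) (t : V) : Finset (V × V) :=
  (A ×ˢ B).filter fun e => (Γ.Near t e.1 ∧ (e.1 ∈ Γ.low ∨ e.2 = c)) ∨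
    (Γ.Near t e.2 ∧ e.1 ∈ Γ.high ∧ e.2 ∈ N)

open Classical in
lemma disjoint_credit {c : V} (hc : c ∉ N) {A B : Finset V} (hA : A ⊆ N) {t u : V}
    (htu : ¬ ∃ y ∈ N, Γ.Near t y ∧ Γ.Near u y) :
    Disjoint (Γ.credit c A B t) (Γ.credit c A B u) := by
  rw [Finset.disjoint_left]
  rintro ⟨a, b⟩ h1 h2
  simp only [credit, Finset.mem_filter, Finset.mem_product] at h1 h2
  obtain ⟨⟨haA, -⟩, h1⟩ := h1
  obtain ⟨-, h2⟩ := h2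
  have hlow : a ∈ Γ.low → a ∈ Γ.high → False := fun h h' => (Γ.mem_low.1 h).2 h'
  rcases h1 with ⟨h1, h1'⟩ | ⟨h1, h1', h1''⟩ <;> rcases h2 with ⟨h2, h2'⟩ | ⟨h2, h2', h2''⟩
  · exact htu ⟨a, hA haA, h1, h2⟩
  · rcases h1' with h | h
    · exact hlow h h2'
    · exact hc (h ▸ h2'')
  · rcases h2' with h | h
    · exact hlow h h1'
    · exact hc (h ▸ h1'')
  · exact htu ⟨b, h1'', h1, h2⟩

open Classical in
/-- Each terminal in `A` receives credit at least `2 * k`. Within `A`, walk from `t` along low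
vertices. If `k` vertices are met, their edges to `c` suffice. If the walk meets a high vertex of
`A`, then each member of the corresponding group contributes its edge to `c` or its edge to that
high vertex. Otherwise the vertices met form a component of `A`, all of whose outgoing edges count.
-/
lemma le_sum_credit {c : V} (hk : 0 < k) (hs : ∀ a b, w a b = w b a)
    (h2 : ∀ x ∈ N, 2 ≤ w x c)
    (hcut : ∀ A ⊆ N, A.Nonempty → 2 * k ≤ cutWeight w A (insert c N \ A))
    {T : Finset V} (hT : T ⊆ Γ.low)
    (hTd : ∀ t ∈ T, ∀ u ∈ T, t ≠ u → ¬ ∃ y ∈ N, Γ.Near t y ∧ Γ.Near u y) (hc : c ∉ N)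
    {A : Finset V} (hA : A ⊆ N) {t : V} (htA : t ∈ A) (htT : t ∈ T) :
    2 * k ≤ ∑ e ∈ Γ.credit c A ((insert c N \ A) \ T) t, w e.1 e.2 := by
  have hlowN : Γ.low ⊆ N := fun x hx => (Γ.mem_low.1 hx).1
  have hcT : c ∉ T := fun h => hc (hlowN (hT h))
  have hcA : c ∉ A := fun h => hc (hA h)
  set B := (insert c N \ A) \ T with hB
  have hcB : c ∈ B := by simp [hB, hcA, hcT]
  have hTnear : ∀ u ∈ T, Γ.Near t u → u = t := by
    intro u hu hnear
    by_contra hne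
    exact hTd t htT u hu (Ne.symm hne) ⟨u, hlowN (hT hu), hnear, Γ.near_self (hT hu)⟩
  set r : V → V → Prop := fun x y => Γ.LowStep x y ∧ x ∈ A ∧ y ∈ A with hr
  have hmem : ∀ {n x}, Within r n t x → x ∈ Γ.low ∩ A := fun {n x} h =>
    Within.mem (S := ((Γ.low ∩ A : Finset V) : Set V))
      (fun x y hxy => Finset.mem_inter.2 ⟨hxy.1.2.1, hxy.2.2⟩)
      (Finset.mem_inter.2 ⟨hT htT, htA⟩) h
  have hwithin : ∀ {n x}, n ≤ k → Within r n t x → Within Γ.LowStep k t x :=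
    fun {n x} hn h => (h.imp fun _ _ h => h.1).mono hn
  have hnear : ∀ {n x}, n ≤ k → Within r n t x → Γ.Near t x := fun {n x} hn h =>
    ⟨x, (Finset.mem_inter.1 (hmem h)).1, hwithin hn h, Or.inl rfl⟩
  -- radius `k - 1` leaves one step of slack to compare with the zones of other terminals
  have hgrow := Within.growth (r := r) (S := Γ.low ∩ A)
    (fun x y hxy => Finset.mem_inter.2 ⟨hxy.1.2.1, hxy.2.2⟩)
    (Finset.mem_inter.2 ⟨hT htT, htA⟩) (k - 1)
  rcases hgrow with hbig | ⟨i, hi, hclosed⟩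
  · set S := (Γ.low ∩ A).filter (Within r (k - 1) t)
    have hsub : S ×ˢ {c} ⊆ Γ.credit c A B t := by
      rintro ⟨a, b⟩ h
      simp only [S, Finset.mem_product, Finset.mem_filter, Finset.mem_inter,
        Finset.mem_singleton] at h
      obtain ⟨⟨⟨ha, haA⟩, haw⟩, rfl⟩ := h
      simp only [credit, Finset.mem_filter, Finset.mem_product]
      exact ⟨⟨haA, hcB⟩, Or.inl ⟨hnear (by omega) haw, Or.inl ha⟩⟩
    refine le_trans ?_ (Finset.sum_le_sum_of_subset hsub)
    rw [Finset.sum_product]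
    simp only [Finset.sum_singleton]
    have : S.card • 2 ≤ ∑ x ∈ S, w x c := Finset.card_nsmul_le_sum _ _ _ fun x hx =>
      h2 x (hA (Finset.mem_inter.1 (Finset.mem_filter.1 hx).1).2)
    rw [smul_eq_mul] at this
    omega
  · by_cases hhigh : ∃ x, Within r i t x ∧ ∃ v ∈ Γ.high, v ∈ A ∧ 0 < w v x
    · obtain ⟨x, hx, v, hv, hvA, hvx⟩ := hhigh
      obtain ⟨hvN, hv8⟩ := Γ.mem_high.1 hv
      have hgcard := (Γ.card_group v hvN hv8 x).1
      set S := (N.filter fun y => v ∈ Γ.out y).filter fun y => Γ.group v y = Γ.group v x with hS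
      have hSnear : ∀ y ∈ S, y ∈ N ∧ 0 < w v y ∧ Γ.Near t y := by
        intro y hy
        simp only [hS, Finset.mem_filter] at hy
        refine ⟨hy.1.1, ?_, x, (Finset.mem_inter.1 (hmem hx)).1, hwithin (by omega) hx,
          Or.inr ⟨v, hv, hvx, Γ.mem_ins.2 hy.1, hy.2⟩⟩
        rw [hs]
        exact Γ.pos_of_mem_out y hy.1.1 v hy.1.2
      -- a member of the group inside `A` contributes its edge to `c`, one outside `A` its edge to `v`
      set f : V → V × V := fun y => if y ∈ A then (y, c) else (v, y) with hf
      have hmaps : ∀ y ∈ S, f y ∈ (Γ.credit c A B t).filter fun e => 1 ≤ w e.1 e.2 := by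
        intro y hy
        obtain ⟨hyN, hvy, hyn⟩ := hSnear y hy
        by_cases hyA : y ∈ A
        · have := h2 y hyN
          simp only [hf, hyA, if_true, credit, Finset.mem_filter, Finset.mem_product]
          exact ⟨⟨⟨trivial, hcB⟩, Or.inl ⟨hyn, Or.inr trivial⟩⟩, by omega⟩
        · have hyT : y ∉ T := fun h => hyA (hTnear y h hyn ▸ htA)
          simp only [hf, hyA, if_false, credit, Finset.mem_filter, Finset.mem_product]
          exact ⟨⟨⟨hvA, by simp [hB, hyN, hyA, hyT]⟩, Or.inr ⟨hyn, hv, hyN⟩⟩, hvy⟩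
      have hinj : Set.InjOn f S := by
        intro y hy z hz hyz
        have hyN := (hSnear y hy).1
        have hzN := (hSnear z hz).1
        simp only [hf] at hyz
        split_ifs at hyz with h1 h3 h3
        · exact congrArg Prod.fst hyz
        · exact absurd (congrArg Prod.snd hyz) (by rintro rfl; exact hc hzN)
        · exact absurd (congrArg Prod.snd hyz) (by rintro rfl; exact hc hyN)
        · exact congrArg Prod.snd hyz
      have hcard := Finset.card_le_card_of_injOn f hmaps hinj
      have hsum : ((Γ.credit c A B t).filter fun e => 1 ≤ w e.1 e.2).card • 1 ≤
          ∑ e ∈ (Γ.credit c A B t).filter fun e => 1 ≤ w e.1 e.2, w e.1 e.2 :=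
        Finset.card_nsmul_le_sum _ _ _ fun e he => (Finset.mem_filter.1 he).2
      rw [smul_eq_mul, mul_one] at hsum
      exact hgcard.trans (hcard.trans (hsum.trans
        (Finset.sum_le_sum_of_subset (Finset.filter_subset _ _))))
    · push Not at hhigh
      set S := (Γ.low ∩ A).filter (Within r i t) with hS
      have hSmem : ∀ x ∈ S, x ∈ Γ.low ∧ x ∈ A ∧ Within r i t x := by
        intro x hx
        simp only [hS, Finset.mem_filter, Finset.mem_inter] at hx
        exact ⟨hx.1.1, hx.1.2, hx.2⟩
      have hSA : S ⊆ A := fun x hx => (hSmem x hx).2.1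
      have htS : t ∈ S := by
        simp only [hS, Finset.mem_filter, Finset.mem_inter]
        exact ⟨⟨hT htT, htA⟩, Within.refl _ _ _⟩
      have hsub : S ×ˢ B ⊆ Γ.credit c A B t := by
        rintro ⟨a, b⟩ h
        obtain ⟨haS, hbB⟩ := Finset.mem_product.1 h
        obtain ⟨ha, haA, haw⟩ := hSmem a haS
        simp only [credit, Finset.mem_filter, Finset.mem_product]
        exact ⟨⟨haA, hbB⟩, Or.inl ⟨hnear (by omega) haw, Or.inl ha⟩⟩
      refine le_trans ?_ (Finset.sum_le_sum_of_subset hsub)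
      rw [Finset.sum_product]
      refine (hcut S (hSA.trans hA) ⟨t, htS⟩).trans (le_of_eq ?_)
      refine Finset.sum_congr rfl fun a haS => (Finset.sum_subset ?_ ?_).symm
      · intro b hb
        simp only [hB, Finset.mem_sdiff] at hb ⊢
        exact ⟨hb.1.1, fun h => hb.1.2 (hSA h)⟩
      · intro b hb hbB
        obtain ⟨ha, haA, haw⟩ := hSmem a haS
        simp only [hB, Finset.mem_sdiff, Finset.mem_insert] at hb hbB
        obtain ⟨hb1, hb2⟩ := hb
        by_contra hne
        have hpos := Nat.pos_of_ne_zero hne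
        rcases hb1 with rfl | hbN
        · exact hbB ⟨⟨Or.inl rfl, hcA⟩, hcT⟩
        by_cases hbA : b ∈ A
        · by_cases hbH : b ∈ Γ.high
          · exact absurd (hhigh a haw b hbH hbA) (by rw [hs]; omega)
          · have hbl : b ∈ Γ.low := Γ.mem_low.2 ⟨hbN, hbH⟩
            have := hclosed a b haw ⟨⟨ha, hbl, hpos⟩, haA, hbA⟩
            exact hb2 (Finset.mem_filter.2 ⟨Finset.mem_inter.2 ⟨hbl, hbA⟩, this⟩)
        · have hbT : b ∈ T := by
            by_contra hbT
            exact hbB ⟨⟨Or.inr hbN, hbA⟩, hbT⟩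
          have hw : Within Γ.LowStep (i + 1) t b :=
            ⟨a, haw.imp fun _ _ h => h.1, Or.inr ⟨ha, hT hbT, hpos⟩⟩
          have := hTnear b hbT ⟨b, hT hbT, hw.mono (by omega), Or.inl rfl⟩
          exact hbA (this ▸ htA)

open Classical in
/-- Terminals that pairwise share no nearby vertex satisfy the cut condition. -/
lemma two_mul_card_le_cutWeight {c : V} (hk : 0 < k) (hs : ∀ a b, w a b = w b a)
    (h2 : ∀ x ∈ N, 2 ≤ w x c)
    (hcut : ∀ A ⊆ N, A.Nonempty → 2 * k ≤ cutWeight w A (insert c N \ A))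
    {T : Finset V} (hT : T ⊆ Γ.low)
    (hTd : ∀ t ∈ T, ∀ u ∈ T, t ≠ u → ¬ ∃ y ∈ N, Γ.Near t y ∧ Γ.Near u y) (hc : c ∉ N)
    {A : Finset V} (hA : A ⊆ N) :
    2 * k * (A ∩ T).card ≤ cutWeight w A ((insert c N \ A) \ T) := by
  set B := (insert c N \ A) \ T
  have h1 : (A ∩ T).card • (2 * k) ≤ ∑ t ∈ A ∩ T, ∑ e ∈ Γ.credit c A B t, w e.1 e.2 :=
    Finset.card_nsmul_le_sum _ _ _ fun t ht => Γ.le_sum_credit hk hs h2 hcut hT hTd hc hA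
      (Finset.mem_inter.1 ht).1 (Finset.mem_inter.1 ht).2
  rw [smul_eq_mul, mul_comm] at h1
  refine h1.trans ?_
  rw [← Finset.sum_biUnion, cutWeight, ← Finset.sum_product' A B w]
  · refine Finset.sum_le_sum_of_subset ?_
    intro e he
    obtain ⟨t, -, he⟩ := Finset.mem_biUnion.1 he
    exact (Finset.mem_filter.1 he).1
  · intro t ht u hu htu
    exact Γ.disjoint_credit hc hA (hTd t (Finset.mem_inter.1 ht).2 u (Finset.mem_inter.1 hu).2 htu)

end Grouping

lemma conflict_bound_le {k : ℕ} (hk : 3 ≤ k) :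
    2 * ((12 * k + 1) ^ k *
      ((1 + 12 * k * (4 * k)) * ((1 + 4 * k * (8 * k)) * (12 * k + 1) ^ k))) ≤
      Graph.immersionBound k := by
  have h1 : 12 * k + 1 ≤ (2 * k + 1) ^ 2 := by nlinarith
  have h2 : 1 + 12 * k * (4 * k) ≤ (2 * k + 1) ^ 4 := by
    have : 9 ≤ k * k := by nlinarith
    nlinarith [Nat.zero_le (k * k * k)]
  have h3 : 1 + 4 * k * (8 * k) ≤ (2 * k + 1) ^ 4 := le_trans (by nlinarith) h2
  have h4 : (12 * k + 1) ^ k ≤ (2 * k + 1) ^ (2 * k) := by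
    rw [pow_mul]; exact Nat.pow_le_pow_left h1 k
  have h5 : 2 ≤ k ^ 2 * (k + 1) := by nlinarith
  calc _ ≤ 2 * ((2 * k + 1) ^ (2 * k) *
        ((2 * k + 1) ^ 4 * ((2 * k + 1) ^ 4 * (2 * k + 1) ^ (2 * k)))) := by gcongr
    _ = (2 * k + 1) ^ (4 * k + 8) * 2 := by
        rw [← pow_add, ← pow_add, ← pow_add, mul_comm]
        congr 2
        ring
    _ ≤ (2 * k + 1) ^ (8 * k + 4) * (k ^ 2 * (k + 1)) :=
        Nat.mul_le_mul (Nat.pow_le_pow_right (by omega) (by omega)) h5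
    _ = Graph.immersionBound k := by rw [Graph.immersionBound, mul_assoc]

open Classical in
/-- In a weighted graph on `N ∪ {c}` all of whose vertices are adjacent to `c`, a small fraction of
the vertices of `N` can be chosen as terminals that satisfy the cut condition for sending `k` units
each to `c` without passing through other terminals. All weights are doubled here. -/
theorem exists_terminals_of_cutWeight {k : ℕ} (hk : 3 ≤ k) {N : Finset V} {c : V} (hc : c ∉ N)
    {w : V → V → ℕ} (hs : ∀ a b, w a b = w b a) (hd : ∀ a, w a a = 0)
    (h2 : ∀ x ∈ N, 2 ≤ w x c)
    (hcut : ∀ A ⊆ N, A.Nonempty → 2 * k ≤ cutWeight w A (insert c N \ A)) {n : ℕ}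
    (hn : Graph.immersionBound k * n ≤ N.card) :
    ∃ T ⊆ N, T.card = n ∧
      ∀ A ⊆ N, 2 * k * (A ∩ T).card ≤ cutWeight w A ((insert c N \ A) \ T) := by
  obtain ⟨w', s1, s2, s3, s4, s5, s6⟩ := exists_minimal_weight hc hs hd hcut
  obtain ⟨O, o1, o2⟩ := exists_orientation (p := 4 * k) s1 N fun X hX hXn => by
    by_contra! hcon
    have e1 := cutWeight_self_add_le s1 s6 hX hXn
    have e2 : X.card • (4 * k) ≤ cutWeight w' X X :=
      Finset.card_nsmul_le_sum _ _ _ fun x hx => (hcon x hx).le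
    rw [smul_eq_mul] at e2
    nlinarith
  have hg : ∀ v : V, ∃ g : V → ℕ, 8 * k ≤ (N.filter fun x => v ∈ O x).card → ∀ x,
      2 * k ≤ ((N.filter fun y => v ∈ O y).filter fun y => g y = g x).card ∧
      ((N.filter fun y => v ∈ O y).filter fun y => g y = g x).card ≤ 2 * (2 * k) := by
    intro v
    by_cases h8 : 8 * k ≤ (N.filter fun x => v ∈ O x).card
    · obtain ⟨g, hg⟩ := exists_groups (m := 2 * k) (by omega) (N.filter fun x => v ∈ O x)
        (by omega)
      exact ⟨g, fun _ => hg⟩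
    · exact ⟨fun _ => 0, fun h => absurd h h8⟩
  choose g hg using hg
  let Γ : Grouping w' N k := {
    out := O
    out_subset := fun x hx => (o1 x hx).1
    card_out_le := fun x hx => (o1 x hx).2.1
    pos_of_mem_out := fun x hx => (o1 x hx).2.2
    mem_out_or := o2
    group := g
    card_group := fun v _ => hg v }
  have hlow := Γ.card_le_two_mul_card_low (by omega)
  have hb := conflict_bound_le hk
  obtain ⟨T, hT, hTn, hTR⟩ := exists_pairwise_not (L := Γ.low)
    (R := fun t u => ∃ y ∈ N, Γ.Near t y ∧ Γ.Near u y)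
    (fun t u ⟨y, hy, h1, h2⟩ => ⟨y, hy, h2, h1⟩)
    (C := (12 * k + 1) ^ k * ((1 + 12 * k * (4 * k)) * ((1 + 4 * k * (8 * k)) * (12 * k + 1) ^ k)))
    (fun t ht => by convert Γ.card_conflict_le s1 ht)
    (fun t ht => ⟨t, (Γ.mem_low.1 ht).1, Γ.near_self ht, Γ.near_self ht⟩)
    (by positivity) n (by
      have := (Nat.mul_le_mul_right n hb).trans hn
      rw [mul_assoc] at this
      omega)
  refine ⟨T, fun t ht => (Γ.mem_low.1 (hT ht)).1, hTn, fun A hA => ?_⟩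
  exact (Γ.two_mul_card_le_cutWeight (by omega) s1 (fun x hx => by rw [s4]; exact h2 x hx) s5 hT hTR
    hc hA).trans (cutWeight_mono_weight fun a _ b _ => s3 a b)

end Zones

/-! ### Terminals in an edge-connected graph -/

namespace Graph

section Terminals

variable {γ δ : Type*}

/-- Twice the number of edges joining `a` and `b`, loops being ignored. The factor makes the weighted
graph Eulerian. -/
noncomputable def doubledMultiplicity (G : Graph γ δ) (a b : γ) : ℕ :=
  open Classical in if a = b then 0 else 2 * {e | G.IsLink e a b}.ncard

lemma IsFinite.finite_arcs {G : Graph γ δ} (hG : G.IsFinite) :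
    {a : γ × γ × δ | G.IsLink a.2.2 a.1 a.2.1}.Finite :=
  (hG.1.prod (hG.1.prod hG.2)).subset fun _ h => ⟨h.left_mem, h.right_mem, h.edge_mem⟩

open Classical in
/-- A cut in the doubled graph consists of twice as many arcs as edges of `G` that cross it. -/
lemma cutWeight_doubledMultiplicity {G : Graph γ δ} (hG : G.IsFinite) {A B : Finset γ}
    (h : Disjoint A B) :
    cutWeight G.doubledMultiplicity A B =
      2 * (hG.finite_arcs.toFinset.filter fun a => a.1 ∈ A ∧ a.2.1 ∈ B).card := by
  have hfin : ∀ a b, {e | G.IsLink e a b}.Finite := fun a b =>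
    hG.2.subset fun e he => IsLink.edge_mem he
  have h1 : (hG.finite_arcs.toFinset.filter fun a => a.1 ∈ A ∧ a.2.1 ∈ B) =
      A.biUnion fun a => B.biUnion fun b => (hfin a b).toFinset.image fun e => (a, b, e) := by
    ext ⟨a, b, e⟩
    simp only [Finset.mem_filter, Set.Finite.mem_toFinset, Set.mem_ofPred_eq, Finset.mem_biUnion,
      Finset.mem_image, Prod.mk.injEq]
    constructor
    · rintro ⟨h1, h2, h3⟩
      exact ⟨a, h2, b, h3, e, h1, rfl, rfl, rfl⟩
    · rintro ⟨a, h2, b, h3, e, h1, rfl, rfl, rfl⟩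
      exact ⟨h1, h2, h3⟩
  rw [h1, Finset.card_biUnion, Finset.mul_sum]
  · refine Finset.sum_congr rfl fun a ha => ?_
    rw [Finset.card_biUnion, Finset.mul_sum]
    · refine Finset.sum_congr rfl fun b hb => ?_
      have hab : a ≠ b := by rintro rfl; exact Finset.disjoint_left.1 h ha hb
      rw [Finset.card_image_of_injective _ (fun e e' h => by simpa using h),
        doubledMultiplicity, if_neg hab, Set.ncard_eq_toFinset_card _ (hfin a b)]
    · intro b _ b' _ hb
      rw [Function.onFun, Finset.disjoint_left]
      rintro ⟨x, y, e⟩ h1 h2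
      simp only [Finset.mem_image, Prod.mk.injEq] at h1 h2
      obtain ⟨-, -, -, rfl, -⟩ := h1
      obtain ⟨-, -, -, rfl, -⟩ := h2
      exact hb rfl
  · intro a _ a' _ ha
    rw [Function.onFun, Finset.disjoint_left]
    rintro ⟨x, y, e⟩ h1 h2
    simp only [Finset.mem_biUnion, Finset.mem_image, Prod.mk.injEq] at h1 h2
    obtain ⟨-, -, -, -, rfl, -⟩ := h1
    obtain ⟨-, -, -, -, rfl, -⟩ := h2
    exact ha rfl

lemma isEulerian_doubledMultiplicity (G : Graph γ δ) (U : Finset γ) :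
    IsEulerian G.doubledMultiplicity U where
  symm a b := by
    unfold doubledMultiplicity
    by_cases h : a = b
    · rw [h]
    · have h' : {e | G.IsLink e a b} = {e | G.IsLink e b a} := Set.ext fun _ => isLink_comm
      rw [if_neg h, if_neg (Ne.symm h), h']
  diag a := by simp [doubledMultiplicity]
  even a _ := Finset.even_sum _ fun b _ => by
    unfold doubledMultiplicity
    split_ifs
    · exact Even.zero
    · exact even_two_mul _

open Classical in
lemma IsEdgeConnected.le_cutWeight {G : Graph γ δ} (hG : G.IsFinite) {k : ℕ}
    (h : G.IsEdgeConnected k) {X : Finset γ} (hX : X ⊆ hG.1.toFinset) (hne : X.Nonempty)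
    (hX' : X ≠ hG.1.toFinset) :
    2 * k ≤ cutWeight G.doubledMultiplicity X (hG.1.toFinset \ X) := by
  rw [cutWeight_doubledMultiplicity hG Finset.disjoint_sdiff]
  set S := hG.finite_arcs.toFinset.filter fun a => a.1 ∈ X ∧ a.2.1 ∈ hG.1.toFinset \ X with hS
  by_contra! hlt
  have hSE : ((S.image fun a => a.2.2 : Finset δ) : Set δ) ⊆ G.edgeSet := by
    intro e he
    simp only [hS, Finset.coe_image, Set.mem_image, Finset.mem_coe, Finset.mem_filter,
      Set.Finite.mem_toFinset, Set.mem_ofPred_eq] at he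
    obtain ⟨a, ha, rfl⟩ := he
    exact ha.1.edge_mem
  have hcard : ((S.image fun a => a.2.2 : Finset δ) : Set δ).encard < k := by
    rw [Set.encard_coe_eq_coe_finsetCard]
    have : (S.image fun a => a.2.2).card ≤ S.card := Finset.card_image_le
    exact_mod_cast (by omega : (S.image fun a => a.2.2).card < k)
  obtain ⟨-, hcon⟩ := h _ hSE hcard
  obtain ⟨x, hx⟩ := hne
  obtain ⟨y, hy, hyX⟩ : ∃ y ∈ hG.1.toFinset, y ∉ X := by
    by_contra! hcon
    exact hX' (Finset.Subset.antisymm hX hcon)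
  have hxV : x ∈ G.vertexSet := hG.1.mem_toFinset.1 (hX hx)
  have hyV : y ∈ G.vertexSet := hG.1.mem_toFinset.1 hy
  have hreach := hcon x (by simpa using hxV) y (by simpa using hyV)
  have : y ∈ X := by
    clear hy hyX hyV
    induction hreach with
    | refl => exact hx
    | tail _ hadj ih =>
      obtain ⟨e, he⟩ := hadj
      rw [deleteEdges_isLink] at he
      by_contra hnot
      refine he.2 ?_
      simp only [hS, Finset.coe_image, Set.mem_image, Finset.mem_coe, Finset.mem_filter,
        Set.Finite.mem_toFinset, Set.mem_ofPred_eq, Finset.mem_sdiff]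
      exact ⟨(_, _, e), ⟨he.1, ih, he.1.right_mem, hnot⟩, rfl⟩
  exact hyX this

open Classical in
/-- In a `k`-edge-connected graph with a vertex `c` of many neighbours there are `n` terminals such
that every vertex set avoiding `c` has at least `k` outgoing edges for each of its terminals, even if
the edges that enter a terminal are not counted. -/
theorem exists_terminals {G : Graph γ δ} (hG : G.IsFinite) {k : ℕ} (hk : 3 ≤ k)
    (h : G.IsEdgeConnected k) {c : γ} (hc : c ∈ G.vertexSet) {n : ℕ}
    (hn : immersionBound k * n ≤ (G.neighbours c).ncard) :
    ∃ T : Finset γ, (T : Set γ) ⊆ G.vertexSet ∧ c ∉ T ∧ T.card = n ∧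
      ∃ D : Finset (γ × γ × δ),
        (∀ a ∈ D, G.IsLink a.2.2 a.1 a.2.1 ∧ a.2.1 ∉ T) ∧
        ∀ A : Finset γ, c ∉ A →
          k * (A ∩ T).card ≤ (outArcs (fun a => a.1) (fun a => a.2.1) D A).card := by
  have hNfin : (G.neighbours c).Finite := hG.1.subset fun x hx => hx.2.right_mem
  set N : Finset γ := hNfin.toFinset with hN
  have hmemN : ∀ x, x ∈ N ↔ x ≠ c ∧ G.Adj c x := fun x => hNfin.mem_toFinset
  set V : Finset γ := hG.1.toFinset with hV
  have hcN : c ∉ N := fun hcN => ((hmemN c).1 hcN).1 rfl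
  have hUV : insert c N ⊆ V := by
    intro x hx
    rcases Finset.mem_insert.1 hx with rfl | hx
    · exact hG.1.mem_toFinset.2 hc
    · exact hG.1.mem_toFinset.2 ((hmemN x).1 hx).2.right_mem
  have hUR : insert c N ∪ (V \ insert c N) = V := Finset.union_sdiff_of_subset hUV
  obtain ⟨w, hw, hwcut, hwle, hwdom⟩ := exists_split_all (K := 2 * k) (even_two_mul k) (insert c N)
    (V \ insert c N) Finset.disjoint_sdiff (G.isEulerian_doubledMultiplicity _)
    (fun X hX hXn hXne => by
      rw [hUR] at *
      exact h.le_cutWeight hG hX hXn hXne)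
  rw [hUR] at hwdom
  obtain ⟨T, hTN, hTn, hTcut⟩ := exists_terminals_of_cutWeight hk hcN hw.symm hw.diag
    (fun x hx => by
      refine le_trans ?_ (hwle x (by simp [hx]) c (by simp))
      obtain ⟨hxc, e, he⟩ := (hmemN x).1 hx
      rw [doubledMultiplicity, if_neg hxc]
      have : 0 < {e | G.IsLink e x c}.ncard :=
        (Set.ncard_pos (hG.2.subset fun e he => IsLink.edge_mem he)).2 ⟨e, he.symm⟩
      omega)
    (fun A hA hAn => hwcut A (hA.trans (Finset.subset_insert c N)) hAn (by
      rintro rfl; exact hcN (hA (by simp))))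
    (n := n) (by rwa [← Set.ncard_eq_toFinset_card _ hNfin])
  have hTV : T ⊆ V := hTN.trans ((Finset.subset_insert c N).trans hUV)
  refine ⟨T, fun x hx => hG.1.mem_toFinset.1 (hTV hx), fun h => hcN (hTN h), hTn,
    hG.finite_arcs.toFinset.filter fun a => a.2.1 ∉ T, fun a ha => by simpa using ha,
    fun A hcA => ?_⟩
  have h1 := hTcut (A ∩ N) Finset.inter_subset_right
  have h2 := hwdom (A ∩ V) Finset.inter_subset_right T (hTN.trans (Finset.subset_insert c N))
  have e1 : A ∩ V ∩ insert c N = A ∩ N := by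
    ext x
    simp only [Finset.mem_inter, Finset.mem_insert]
    constructor
    · rintro ⟨⟨hx, -⟩, rfl | hxN⟩
      · exact absurd hx hcA
      · exact ⟨hx, hxN⟩
    · rintro ⟨hx, hxN⟩
      exact ⟨⟨hx, hUV (by simp [hxN])⟩, Or.inr hxN⟩
  have e2 : insert c N \ (A ∩ V) = insert c N \ (A ∩ N) := by
    ext x
    simp only [Finset.mem_sdiff, Finset.mem_inter, Finset.mem_insert]
    have : x ∈ N → x ∈ V := fun h => hUV (by simp [h])
    grind
  have e3 : A ∩ N ∩ T = A ∩ T := by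
    ext x
    simp only [Finset.mem_inter]
    exact ⟨fun h => ⟨h.1.1, h.2⟩, fun h => ⟨⟨h.1, hTN h.2⟩, h.2⟩⟩
  rw [e1, e2] at h2
  rw [e3] at h1
  have hdisj : Disjoint (A ∩ V) ((V \ (A ∩ V)) \ T) :=
    Finset.disjoint_of_subset_right Finset.sdiff_subset Finset.disjoint_sdiff
  rw [cutWeight_doubledMultiplicity hG hdisj] at h2
  have h3 : (hG.finite_arcs.toFinset.filter fun a => a.1 ∈ A ∩ V ∧ a.2.1 ∈ (V \ (A ∩ V)) \ T) ⊆
      outArcs (fun a => a.1) (fun a => a.2.1)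
        (hG.finite_arcs.toFinset.filter fun a => a.2.1 ∉ T) A := by
    intro a
    simp only [outArcs, Finset.mem_filter, Finset.mem_inter, Finset.mem_sdiff]
    tauto
  have h4 := Finset.card_le_card h3
  have h5 := h1.trans h2
  rw [mul_assoc] at h5
  omega

end Terminals

/-! ### Cycles and unions of trails -/

section Cycle

variable {γ δ : Type*}

/-- An edge whose ends are joined by a walk that does not use it lies on a cycle. -/
lemma hasCycleThrough_of_reflTransGen {H : Graph γ δ} {f : δ} {t u : γ} (hf : H.IsLink f t u)
    (h : Relation.ReflTransGen (fun x y => ∃ g ≠ f, H.IsLink g x y) t u) :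
    H.HasCycleThrough t := by
  classical
  let S : SimpleGraph γ :=
    { Adj := fun x y => x ≠ y ∧ ∃ g ≠ f, H.IsLink g x y
      symm := ⟨fun x y h => ⟨h.1.symm, h.2.imp fun g hg => ⟨hg.1, hg.2.symm⟩⟩⟩
      loopless := ⟨fun x h => h.1 rfl⟩ }
  have hr : S.Reachable t u := by
    clear hf
    induction h with
    | refl => exact SimpleGraph.Reachable.refl _
    | @tail x y _ hxy ih =>
      by_cases hne : x = y
      · exact hne ▸ ih
      · exact ih.trans (SimpleGraph.Adj.reachable (G := S) ⟨hne, hxy⟩)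
  obtain ⟨p, hp⟩ := hr.exists_isPath
  have hadj : ∀ i, i < p.length → ∃ g ≠ f, H.IsLink g (p.getVert i) (p.getVert (i + 1)) :=
    fun i hi => (p.adj_getVert_succ hi).2
  have : Nonempty δ := ⟨f⟩
  choose! g hgf hg using hadj
  refine ⟨p.length + 1, inferInstance, fun i => p.getVert i,
    fun i => if (i : ℕ) < p.length then g i else f, ?_, ?_, ?_, by simp⟩
  · intro i j hij
    exact Fin.ext (hp.getVert_injOn (Nat.lt_succ_iff.1 i.2) (Nat.lt_succ_iff.1 j.2) hij)
  · intro i j hij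
    have hi := Nat.lt_succ_iff.1 i.2
    have hj := Nat.lt_succ_iff.1 j.2
    dsimp only at hij
    split_ifs at hij with h1 h2 h2
    · have h3 := hg i h1
      rw [hij] at h3
      have hinj : ∀ a b, a ≤ p.length → b ≤ p.length → p.getVert a = p.getVert b → a = b :=
        fun a b ha hb hab => hp.getVert_injOn ha hb hab
      rcases h3.eq_and_eq_or_eq_and_eq (hg j h2) with ⟨h4, -⟩ | ⟨h4, h5⟩
      · exact Fin.ext (hinj _ _ hi hj h4)
      · have := hinj _ _ hi (by omega) h4
        have := hinj _ _ (by omega) hj h5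
        omega
    · exact absurd hij (hgf i h1)
    · exact absurd hij.symm (hgf j h2)
    · exact Fin.ext (by omega)
  · intro i
    have hi := Nat.lt_succ_iff.1 i.2
    by_cases h1 : (i : ℕ) < p.length
    · have h2 : ((i + 1 : Fin (p.length + 1)) : ℕ) = i + 1 :=
        Fin.val_add_one_of_lt (by rw [Fin.lt_def]; simpa using h1)
      simp only [h1, if_true, h2]
      exact hg i h1
    · have h2 : i = Fin.last p.length := Fin.ext (by simp; omega)
      subst h2
      simpa using hf.symm

/-- The last departure from `a` on a walk from `a` to `c`. -/
lemma _root_.Relation.ReflTransGen.exists_last_departure {r : γ → γ → Prop} {a c : γ}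
    (h : Relation.ReflTransGen r a c) (hac : a ≠ c) :
    ∃ u, u ≠ a ∧ r a u ∧ Relation.ReflTransGen (fun x y => r x y ∧ x ≠ a ∧ y ≠ a) u c := by
  have key : ∀ b, Relation.ReflTransGen r a b → b = a ∨
      ∃ u, u ≠ a ∧ r a u ∧ Relation.ReflTransGen (fun x y => r x y ∧ x ≠ a ∧ y ≠ a) u b := by
    intro b hb
    induction hb with
    | refl => exact Or.inl rfl
    | @tail b d _ hbd ih =>
      by_cases hd : d = a
      · exact Or.inl hd
      right
      by_cases hb : b = a
      · subst hb
        exact ⟨d, hd, hbd, Relation.ReflTransGen.refl⟩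
      · obtain hb' | ⟨u, hu, hau, hub⟩ := ih
        · exact absurd hb' hb
        · exact ⟨u, hu, hau, hub.tail ⟨hbd, hb, hd⟩⟩
  exact (key c h).resolve_left (Ne.symm hac)

end Cycle

section TrailGraph

variable {γ δ τ : Type*}

/-- Reachability along arcs that are recorded as triples of tail, head and edge. -/
abbrev Reaches (P : Finset (γ × γ × δ)) : γ → γ → Prop :=
  ArcReach (fun a : γ × γ × δ => a.1) (fun a => a.2.1) P

/-- The subgraph of `G` that is the union of the trails `P x`, for `x ∈ I`, where `P x` starts at
`p x`. -/
def trailGraph (G : Graph γ δ) (I : Set τ) (P : τ → Finset (γ × γ × δ)) (p : τ → γ)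
    (hP : ∀ x ∈ I, ∀ a ∈ P x, G.IsLink a.2.2 a.1 a.2.1 ∧ Reaches (P x) (p x) a.1) :
    Graph γ δ where
  vertexSet := {v | ∃ x ∈ I, Reaches (P x) (p x) v}
  IsLink e u v := G.IsLink e u v ∧ ∃ x ∈ I, (u, v, e) ∈ P x ∨ (v, u, e) ∈ P x
  isLink_symm _ _ := ⟨fun _ _ h => ⟨h.1.symm, h.2.imp fun _ hx => ⟨hx.1, hx.2.symm⟩⟩⟩
  eq_or_eq_of_isLink_of_isLink _ _ _ _ _ h h' := h.1.left_eq_or_eq h'.1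
  left_mem_of_isLink := by
    rintro e u v ⟨-, x, hx, h | h⟩
    · exact ⟨x, hx, (hP x hx _ h).2⟩
    · exact ⟨x, hx, (hP x hx _ h).2.tail ⟨_, h, rfl, rfl⟩⟩

variable {G : Graph γ δ} {I : Set τ} {P : τ → Finset (γ × γ × δ)} {p : τ → γ}
  (hP : ∀ x ∈ I, ∀ a ∈ P x, G.IsLink a.2.2 a.1 a.2.1 ∧ Reaches (P x) (p x) a.1)

lemma isLink_trailGraph_of_mem {x : τ} (hx : x ∈ I) {a : γ × γ × δ} (ha : a ∈ P x) :
    (G.trailGraph I P p hP).IsLink a.2.2 a.1 a.2.1 :=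
  ⟨(hP x hx a ha).1, x, hx, Or.inl ha⟩

lemma trailGraph_le (hp : ∀ x ∈ I, p x ∈ G.vertexSet) : G.trailGraph I P p hP ≤ G := by
  refine ⟨?_, fun _ _ _ h => h.1⟩
  rintro v ⟨x, hx, hv⟩
  induction hv with
  | refl => exact hp x hx
  | tail _ h _ =>
    obtain ⟨a, ha, -, rfl⟩ := h
    exact (hP x hx a ha).1.right_mem

lemma exists_arc_of_mem_edgeSet {e : δ} (he : e ∈ (G.trailGraph I P p hP).edgeSet) :
    ∃ x ∈ I, ∃ a ∈ P x, a.2.2 = e := by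
  obtain ⟨u, v, -, x, hx, h | h⟩ := he
  · exact ⟨x, hx, _, h, rfl⟩
  · exact ⟨x, hx, _, h, rfl⟩

lemma trailGraph_connected {c : γ} (hI : I.Nonempty) (hc : ∀ x ∈ I, Reaches (P x) (p x) c) :
    (G.trailGraph I P p hP).IsConnected := by
  have hlift : ∀ x ∈ I, ∀ u v, Reaches (P x) u v →
      Relation.ReflTransGen (G.trailGraph I P p hP).Adj u v := by
    intro x hx u v huv
    refine Relation.ReflTransGen.mono (fun u v h => ?_) _ _ huv
    obtain ⟨a, ha, rfl, rfl⟩ := h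
    exact ⟨_, isLink_trailGraph_of_mem hP hx ha⟩
  have hsymm : ∀ u v, Relation.ReflTransGen (G.trailGraph I P p hP).Adj u v →
      Relation.ReflTransGen (G.trailGraph I P p hP).Adj v u := by
    intro u v h
    induction h with
    | refl => exact Relation.ReflTransGen.refl
    | tail _ h ih => exact ih.head h.symm
  refine ⟨?_, ?_⟩
  · obtain ⟨x, hx⟩ := hI
    exact ⟨c, x, hx, hc x hx⟩
  · rintro u ⟨x, hx, hu⟩ v ⟨y, hy, hv⟩
    exact (hsymm _ _ (hlift x hx _ _ hu)).trans ((hlift x hx _ _ (hc x hx)).trans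
      ((hsymm _ _ (hlift y hy _ _ (hc y hy))).trans (hlift y hy _ _ hv)))

/-- Two edge-disjoint trails from `p x` to `c` contain a cycle through their common start: leave it
for the last time on one trail, proceed to `c`, and return on the other trail. -/
lemma hasCycleThrough_trailGraph {c : γ} {x y : τ} (hx : x ∈ I) (hy : y ∈ I) (hxy : p x = p y)
    (hxc : p x ≠ c) (hcx : Reaches (P x) (p x) c) (hcy : Reaches (P y) (p y) c)
    (hdisj : ∀ a ∈ P x, ∀ b ∈ P y, a.2.2 ≠ b.2.2) :
    (G.trailGraph I P p hP).HasCycleThrough (p x) := by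
  obtain ⟨u, -, ⟨a, ha, ha1, ha2⟩, huc⟩ := hcx.exists_last_departure hxc
  have hlink := isLink_trailGraph_of_mem hP hx ha
  have hsymm : ∀ v w, Relation.ReflTransGen
        (fun x y => ∃ g ≠ a.2.2, (G.trailGraph I P p hP).IsLink g x y) v w →
      Relation.ReflTransGen
        (fun x y => ∃ g ≠ a.2.2, (G.trailGraph I P p hP).IsLink g x y) w v := by
    intro v w h
    induction h with
    | refl => exact Relation.ReflTransGen.refl
    | tail _ h ih =>
      obtain ⟨g, hg, h⟩ := h
      exact ih.head ⟨g, hg, h.symm⟩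
  dsimp only at ha1 ha2
  rw [ha1, ha2] at hlink
  refine hasCycleThrough_of_reflTransGen hlink (Relation.ReflTransGen.trans (b := c) ?_
    (hsymm _ _ ?_))
  · rw [hxy]
    refine Relation.ReflTransGen.mono (fun v w h => ?_) _ _ hcy
    obtain ⟨b, hb, rfl, rfl⟩ := h
    exact ⟨b.2.2, (hdisj a ha b hb).symm, isLink_trailGraph_of_mem hP hy hb⟩
  · refine Relation.ReflTransGen.mono (fun v w h => ?_) _ _ huc
    obtain ⟨⟨b, hb, rfl, rfl⟩, h1, h2⟩ := h
    have hb' := isLink_trailGraph_of_mem hP hx hb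
    refine ⟨b.2.2, fun heq => ?_, hb'⟩
    rw [heq] at hb'
    rcases hlink.left_eq_or_eq hb' with h | h
    · exact h1 h.symm
    · exact h2 h.symm

end TrailGraph

/-! ### Half-edges and the immersion -/

section HalfEdges

variable {α β : Type*}

/-- The half-edges of `F`: a vertex `v` with an incident edge, and for loops a second copy marked by
`true`. -/
def halfEdges (F : Graph α β) : Set (α × β × Bool) :=
  {x | F.Inc x.2.1 x.1 ∧ (x.2.2 = true → F.IsLoopAt x.2.1 x.1)}

lemma IsFinite.finite_halfEdges {F : Graph α β} (hF : F.IsFinite) : F.halfEdges.Finite :=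
  (hF.1.prod (hF.2.prod Set.finite_univ)).subset fun _ h =>
    ⟨h.1.vertex_mem, h.1.edge_mem, Set.mem_univ _⟩

open Classical in
lemma card_halfEdges_le {F : Graph α β} (hF : F.IsFinite) {k : ℕ} (hdeg : F.MaxDegreeLE k) {v : α}
    (hv : v ∈ F.vertexSet) :
    (hF.finite_halfEdges.toFinset.filter fun x => x.1 = v).card ≤ k := by
  have hi : (F.incidenceSet v).Finite := hF.2.subset (F.incidenceSet_subset_edgeSet v)
  have hl : (F.loopSet v).Finite := hi.subset (F.loopSet_subset_incidenceSet v)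
  have h := hdeg v hv
  rw [vertexDegree, hi.encard_eq_coe_toFinset_card, hl.encard_eq_coe_toFinset_card] at h
  have h' : hi.toFinset.card + hl.toFinset.card ≤ k := by exact_mod_cast h
  have hsub : (hF.finite_halfEdges.toFinset.filter fun x => x.1 = v) ⊆
      (hi.toFinset.image fun e => (v, e, false)) ∪ hl.toFinset.image fun e => (v, e, true) := by
    rintro ⟨w, e, b⟩ h
    simp only [Finset.mem_filter, Set.Finite.mem_toFinset, halfEdges, Set.mem_ofPred_eq] at h
    obtain ⟨⟨h1, h2⟩, rfl⟩ := h
    cases b with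
    | false => simp [h1]
    | true => simp [h2]
  refine (Finset.card_le_card hsub).trans ((Finset.card_union_le _ _).trans ?_)
  exact (Nat.add_le_add Finset.card_image_le Finset.card_image_le).trans h'

open Classical in
/-- The half-edges, placed at pairwise different terminals, satisfy the cut condition. -/
lemma cutCondition_halfEdges {γ δ : Type*} {F : Graph α β} (hF : F.IsFinite) {k : ℕ}
    (hdeg : F.MaxDegreeLE k) {φ : α → γ} (hφ : Set.InjOn φ F.vertexSet) {T : Finset γ}
    (hφT : ∀ v ∈ F.vertexSet, φ v ∈ T) {c : γ} {D : Finset (γ × γ × δ)}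
    (hD : ∀ A : Finset γ, c ∉ A →
      k * (A ∩ T).card ≤ (outArcs (fun a => a.1) (fun a => a.2.1) D A).card) :
    CutCondition (fun a => a.1) (fun a => a.2.1) c hF.finite_halfEdges.toFinset
      (fun x => φ x.1) D := by
  intro A hA
  refine le_trans ?_ (hD A hA)
  set S := tokensIn (fun x : α × β × Bool => φ x.1) hF.finite_halfEdges.toFinset A with hS
  have hmem : ∀ x ∈ S, x.1 ∈ F.vertexSet ∧ φ x.1 ∈ A := by
    intro x hx
    simp only [hS, tokensIn, Finset.mem_filter, Set.Finite.mem_toFinset] at hx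
    exact ⟨hx.1.1.vertex_mem, hx.2⟩
  have h1 : S.card ≤ k * (S.image fun x => φ x.1).card := by
    refine Finset.card_le_mul_card_image S k fun a ha => ?_
    obtain ⟨x, hx, rfl⟩ := Finset.mem_image.1 ha
    refine le_trans (Finset.card_le_card ?_) (card_halfEdges_le hF hdeg (hmem x hx).1)
    intro y hy
    rw [Finset.mem_filter] at hy ⊢
    exact ⟨(Finset.mem_filter.1 hy.1).1, hφ (hmem y hy.1).1 (hmem x hx).1 hy.2⟩
  refine h1.trans (Nat.mul_le_mul_left k (Finset.card_le_card ?_))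
  intro a ha
  obtain ⟨x, hx, rfl⟩ := Finset.mem_image.1 ha
  exact Finset.mem_inter.2 ⟨(hmem x hx).2, hφT _ (hmem x hx).1⟩

/-- Terminals with the cut condition carry a strong immersion: an edge is mapped to the union of the
trails of its half-edges. -/
theorem stronglyImmersed_of_terminals {γ δ : Type*} {F : Graph α β} (hF : F.IsFinite)
    {G : Graph γ δ} {c : γ} {T : Finset γ}
    (hTG : (T : Set γ) ⊆ G.vertexSet) (hcT : c ∉ T) {φ : α → γ} (hφ : Set.InjOn φ F.vertexSet)
    (hφT : ∀ v ∈ F.vertexSet, φ v ∈ T) {D₀ : Finset (γ × γ × δ)}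
    (hD₀ : ∀ a ∈ D₀, G.IsLink a.2.2 a.1 a.2.1 ∧ a.2.1 ∉ T)
    (hcut : CutCondition (fun a => a.1) (fun a => a.2.1) c hF.finite_halfEdges.toFinset
      (fun x => φ x.1) D₀) :
    F.StronglyImmersed G := by
  -- minimality prevents an edge from being used in both directions
  obtain ⟨D, hDD₀, hmin⟩ := exists_minimal_le_of_wellFoundedLT
    (CutCondition (fun a : γ × γ × δ => a.1) (fun a => a.2.1) c hF.finite_halfEdges.toFinset
      (fun x => φ x.1)) D₀ hcut
  obtain ⟨P, hPD, hPdisj, hPc, hPr⟩ := hmin.prop.exists_trails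
  simp only [Set.Finite.mem_toFinset] at hPD hPdisj hPc hPr
  -- trails of different half-edges share no edge of `G`, not even in opposite directions
  have hedge : ∀ x ∈ F.halfEdges, ∀ y ∈ F.halfEdges, x ≠ y → ∀ a ∈ P x, ∀ b ∈ P y,
      a.2.2 ≠ b.2.2 := by
    intro x hx y hy hxy a ha b hb hab
    have ha' := (hD₀ a (hDD₀ (hPD x hx ha))).1
    have hb' := (hD₀ b (hDD₀ (hPD y hy hb))).1
    rw [hab] at ha'
    rcases ha'.eq_and_eq_or_eq_and_eq hb' with ⟨h1, h2⟩ | ⟨h1, h2⟩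
    · have : a = b := Prod.ext h1 (Prod.ext h2 hab)
      exact Finset.disjoint_left.1 (hPdisj x hx y hy hxy) ha (this ▸ hb)
    · exact not_opposite_of_minimal _ _ hmin (hPD x hx ha) (hPD y hy hb) h1 h2
  have hP : ∀ e : β, ∀ x ∈ {x ∈ F.halfEdges | x.2.1 = e}, ∀ a ∈ P x,
      G.IsLink a.2.2 a.1 a.2.1 ∧ Reaches (P x) (φ x.1) a.1 := fun e x hx a ha =>
    ⟨(hD₀ a (hDD₀ (hPD x hx.1 ha))).1, hPr x hx.1 a ha⟩
  refine ⟨{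
    vert := fun v => ⟨φ v, hTG (hφT v v.2)⟩
    edge := fun e => G.trailGraph {x ∈ F.halfEdges | x.2.1 = e} P (fun x => φ x.1) (hP e)
    vert_injective := fun u v huv => Subtype.ext (hφ u.2 v.2 (congrArg Subtype.val huv))
    edge_le := fun e => trailGraph_le _ fun x hx => hTG (hφT _ hx.1.1.vertex_mem)
    edge_connected := fun e => trailGraph_connected (c := c) _ ?_ fun x hx => hPc x hx.1
    edge_disjoint := ?_
    mem_of_inc := fun e v hev =>
      ⟨(v, e, false), ⟨⟨hev, by simp⟩, rfl⟩, Relation.ReflTransGen.refl⟩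
    cycle_of_loop := ?_ }, ?_⟩
  · obtain ⟨u, v, huv⟩ := exists_isLink_of_mem_edgeSet e.2
    exact ⟨(u, e, false), ⟨huv.inc_left, by simp⟩, rfl⟩
  · intro e f hef
    rw [Set.disjoint_left]
    intro g hge hgf
    obtain ⟨x, ⟨hx, hxe⟩, a, ha, rfl⟩ := exists_arc_of_mem_edgeSet _ hge
    obtain ⟨y, ⟨hy, hyf⟩, b, hb, hab⟩ := exists_arc_of_mem_edgeSet _ hgf
    refine hedge x hx y hy ?_ a ha b hb hab.symm
    rintro rfl
    exact hef (Subtype.ext (hxe.symm.trans hyf))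
  · intro e v hev
    have hx : ((v, e, false) : α × β × Bool) ∈ {x ∈ F.halfEdges | x.2.1 = e} :=
      ⟨⟨hev.inc, by simp⟩, rfl⟩
    have hy : ((v, e, true) : α × β × Bool) ∈ {x ∈ F.halfEdges | x.2.1 = e} :=
      ⟨⟨hev.inc, fun _ => hev⟩, rfl⟩
    refine hasCycleThrough_trailGraph (p := fun x => φ x.1) (hP e) hx hy rfl ?_
      (hPc _ hx.1) (hPc _ hy.1) (hedge _ hx.1 _ hy.1 (by simp))
    intro h
    exact hcT (h ▸ hφT v v.2)
  · rintro e v hev ⟨x, ⟨hx, hxe⟩, hreach⟩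
    rcases Relation.ReflTransGen.cases_tail hreach with h | ⟨u, -, a, ha, -, h⟩
    · have : (v : α) = x.1 := hφ v.2 hx.1.vertex_mem h
      exact hev (by rw [this, ← hxe]; exact hx.1)
    · refine (hD₀ a (hDD₀ (hPD x hx ha))).2 ?_
      dsimp only at h
      rw [h]
      exact hφT v v.2

end HalfEdges

end Graph

theorem corollary3 {α β γ δ : Type*} (k : ℕ) (hk : 3 ≤ k)
    (F : Graph α β) (hF : F.IsFinite) (hdeg : F.MaxDegreeLE k)
    (G : Graph γ δ) (hG : G.IsFinite) (hconn : G.IsEdgeConnected k)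
    (hc : ∃ c ∈ G.vertexSet,
      Graph.immersionBound k * F.vertexSet.ncard ≤ (G.neighbours c).ncard) :
    F.StronglyImmersed G := by
  obtain ⟨c, hcG, hcn⟩ := hc
  obtain ⟨T, hTG, hcT, hTn, D, hD, hDcut⟩ := Graph.exists_terminals hG hk hconn hcG hcn
  obtain ⟨φ, hφT, hφ⟩ : ∃ φ : α → γ, (∀ v ∈ F.vertexSet, φ v ∈ T) ∧ Set.InjOn φ F.vertexSet := by
    rcases F.vertexSet.eq_empty_or_nonempty with h | ⟨v, hv⟩
    · exact ⟨fun _ => c, by simp [h], by simp [h]⟩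
    · have : Nonempty γ := ⟨c⟩
      have hle : F.vertexSet.encard ≤ (T : Set γ).encard := by
        rw [Set.encard_coe_eq_coe_finsetCard, hTn, hF.1.cast_ncard_eq]
      obtain ⟨φ, h1, h2⟩ := hF.1.exists_injOn_of_encard_le hle
      exact ⟨φ, fun v hv => h1 hv, h2⟩
  exact Graph.stronglyImmersed_of_terminals hF hTG hcT hφ hφT hD
    (Graph.cutCondition_halfEdges hF hdeg hφ hφT hDcut)
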